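/- For a positive integer $n$ write $[n]=\{1,\dots,n\}$. An $n$-sided die is a sequence $A=(a_1,\dots,a_n)\in[n]^n$ with $\sum_i a_i=n(n+1)/2$, and a random die is one chosen uniformly among all $n$-sided dice. For a die $A$ and $j\in[n]$ let $$f_A(j)=|\{i: a_i<j\}|+\tfrac12|\{i:a_i=j\}|,\qquad g_A(j)=f_A(j)-j+\tfrac12 .$$ Let $(U,V)=(g_A(j),\,j-(n+1)/2)$ with $j$ uniformly distributed on $[n]$, and let $\hat f(\alpha,\beta)=\mathbb E\exp\bigl(2\pi i(\alpha U+\beta V)\bigr)$ be its characteristic function. Then for every sufficiently large $n$ (that is, for all $n\ge N$ with an absolute constant $N$), with probability at least $1-n^{-5}$ over the choice of a random die $A$, we have $$|\hat f(\alpha,\beta)|^n\le n^{-10}$$ simultaneously for all $(\alpha,\beta)\in[-1/2,1/2]^2$ such that $|\alpha|\ge 10^7\,\frac{\log n}{n}$ or $|\beta|\ge 10^9\bigl(\frac{\log n}{n}\bigr)^{3/2}$. -/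

import Mathlib

open MeasureTheory ProbabilityTheory

noncomputable section

namespace IntransitiveDice

/-- The `n`-sided dice of the balanced sequences model: the sequences of `n` elements of
`{1, …, n}` whose sum is `n (n + 1) / 2` (the division is exact). -/
def dice (n : ℕ) : Set (Fin n → ℕ) :=
  {a | (∀ i, a i ∈ Set.Icc 1 n) ∧ ∑ i, a i = n * (n + 1) / 2}

/-- The law of a random `n`-sided die: the uniform distribution on `dice n`. -/
def randomDie (n : ℕ) : Measure (Fin n → ℕ) :=
  uniformOn (dice n)

/-- `f_A(j) = |{i : a_i < j}| + (1/2) |{i : a_i = j}|`. -/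
def cumul {n : ℕ} (a : Fin n → ℕ) (j : ℕ) : ℝ :=
  ((Finset.univ.filter fun i => a i < j).card : ℝ) +
    1 / 2 * ((Finset.univ.filter fun i => a i = j).card : ℝ)

/-- `g_A(j) = f_A(j) - j + 1/2`. -/
def dev {n : ℕ} (a : Fin n → ℕ) (j : ℕ) : ℝ :=
  cumul a j - j + 1 / 2

/-- The random vector `(U, V) = (g_A(j), j - (n + 1) / 2)`, as a function of the outcome `j`. -/
def pairUV {n : ℕ} (a : Fin n → ℕ) (j : ℕ) : ℝ × ℝ :=
  (dev a j, (j : ℝ) - ((n : ℝ) + 1) / 2)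

/-- The law of `(U, V)` when `j` is uniformly distributed on `{1, …, n}`. -/
def lawUV {n : ℕ} (a : Fin n → ℕ) : Measure (ℝ × ℝ) :=
  (uniformOn (Set.Icc 1 n)).map (pairUV a)

/-- `e(x) = exp(2 π i x)`. -/
def expCircle (x : ℝ) : ℂ :=
  Complex.exp (2 * Real.pi * Complex.I * x)

/-- The characteristic function `E e(α U + β V)` of `(U, V)`. -/
def charFn {n : ℕ} (a : Fin n → ℕ) (α β : ℝ) : ℂ :=
  ∫ p, expCircle (α * p.1 + β * p.2) ∂(lawUV a)

end IntransitiveDice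

end

/-! It suffices to show `|∑_j e(x_j)| ≤ n - 10 log n` for the phases `x_j = α g_A(j) + β (j -
(n+1)/2)`, since `(1 - 10 log n / n)^n ≤ n^(-10)`. Rotating the sum onto the real axis gives `|∑
e(x_j)| ≤ n - 8 ∑ ‖x_j - θ‖²` for some `θ`, with `‖·‖` the distance to the nearest integer.
Differencing in `j` removes `θ`.

Second differences at scale `L` also remove the `β` term, leaving `α` times a sum over the sides of
`A` that is typically of size `√L`. As long as `|α| √L` is too small to wrap around the circle, this
saves about `α² n L`, uniformly in `β`. Scale `L = 1` handles `|α| ≥ 625 √(log n / n)`, and `L ≈ n /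
(10^8 log n)` handles the range down to `10^7 log n / n`. For smaller `α`, `|β|` is large; since
`|g_A| ≤ 5 √(n log n)`, the term `α g_A` is a small perturbation of the linear phase, and a first
difference with a suitable shift gives the saving.

What is needed of `A` is thus a sup bound on `g_A` and a lower bound on `fluctuation` at two scales.
Both are proved for i.i.d. uniform sides by bounded differences (`card_lower_tail_le`). Conditioning
on the sum costs a factor of at most `n²`: there are at most `n²` possible sums, and the prescribed
one, being central, is a most likely one (`pow_le_sq_mul_sumCount`). -/

open scoped BigOperators

namespace IntransitiveDice

/-! ### Bounded differences for uniform product spaces. -/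

section Concentration

variable {Ω : Type*} [Fintype Ω]

theorem expect_cons (m : ℕ) (F : (Fin (m + 1) → Ω) → ℝ) :
    𝔼 x, F x = 𝔼 a, 𝔼 y : Fin m → Ω, F (Fin.cons a y) := by
  rw [← Finset.expect_product' Finset.univ Finset.univ fun a (y : Fin m → Ω) => F (Fin.cons a y)]
  refine (Fintype.expect_equiv (Fin.consEquiv fun _ : Fin (m + 1) => Ω) _ _ ?_).symm
  rintro ⟨a, y⟩
  rfl

theorem abs_sub_expect_le [Nonempty Ω] {f : Ω → ℝ} {c : ℝ} (h : ∀ a b, |f a - f b| ≤ c) (a : Ω) :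
    |f a - 𝔼 b, f b| ≤ c := by
  have : f a - 𝔼 b, f b = 𝔼 b, (f a - f b) := by
    rw [Finset.expect_sub_distrib, Fintype.expect_const]
  rw [this]
  exact (Finset.abs_expect_le _ _).trans
    (Finset.expect_le Finset.univ_nonempty fun b _ => h a b)

/-- Hoeffding's lemma for the uniform distribution, with a non-optimal constant. -/
theorem expect_exp_le [Nonempty Ω] {f : Ω → ℝ} {c : ℝ} (hc : 0 < c)
    (h : ∀ a b, |f a - f b| ≤ c) :
    𝔼 a, Real.exp (f a) ≤ Real.exp (𝔼 a, f a + c ^ 2 / 2) := by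
  set μ := 𝔼 a, f a with hμ
  -- Chord bound for `exp` on `[-c, c]`: the linear term averages to zero, and `cosh c ≤ exp
  -- (c²/2)`.
  have key : ∀ a, Real.exp (f a) ≤
      Real.exp μ * (Real.cosh c + (f a - μ) * (Real.sinh c / c)) := by
    intro a
    have h1 := abs_sub_expect_le h a
    have h2 := Real.exp_mul_le_cosh_add_mul_sinh (t := (f a - μ) / c)
      (by rw [abs_div, abs_of_pos hc]; exact (div_le_one hc).2 h1) c
    rw [div_mul_cancel₀ _ hc.ne'] at h2
    calc Real.exp (f a) = Real.exp μ * Real.exp (f a - μ) := by rw [← Real.exp_add]; ring_nf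
      _ ≤ _ := by
        refine mul_le_mul_of_nonneg_left (h2.trans (le_of_eq ?_)) (Real.exp_pos _).le
        ring
  have hz : 𝔼 a, (f a - μ) = 0 := by
    rw [Finset.expect_sub_distrib, Fintype.expect_const, hμ, sub_self]
  calc 𝔼 a, Real.exp (f a)
      ≤ 𝔼 a, Real.exp μ * (Real.cosh c + (f a - μ) * (Real.sinh c / c)) :=
        Finset.expect_le_expect fun a _ => key a
    _ = Real.exp μ * Real.cosh c := by
        rw [← Finset.mul_expect, Finset.expect_add_distrib, Fintype.expect_const,
          ← Finset.expect_mul, hz, zero_mul, add_zero]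
    _ ≤ _ := by
        rw [Real.exp_add]
        exact mul_le_mul_of_nonneg_left (Real.cosh_le_exp_half_sq c) (Real.exp_pos _).le

/-- The exponential moment form of the bounded differences inequality. -/
theorem expect_exp_le_of_bounded_differences [Nonempty Ω] {c : ℝ} (hc : 0 < c) :
    ∀ (m : ℕ) (F : (Fin m → Ω) → ℝ),
      (∀ x i a, |F (Function.update x i a) - F x| ≤ c) →
      𝔼 x, Real.exp (F x) ≤ Real.exp (𝔼 x, F x + m * (c ^ 2 / 2)) := by
  intro m
  induction m with
  | zero =>
    intro F _
    have : ∀ x, F x = F default := fun x => congrArg F (Subsingleton.elim _ _)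
    simp only [this, Fintype.expect_const]
    simp
  | succ m ih =>
    intro F hF
    rw [expect_cons, expect_cons]
    have h1 : ∀ a, 𝔼 y : Fin m → Ω, Real.exp (F (Fin.cons a y)) ≤
        Real.exp (𝔼 y : Fin m → Ω, F (Fin.cons a y)) * Real.exp (m * (c ^ 2 / 2)) := by
      intro a
      rw [← Real.exp_add]
      refine ih (fun y => F (Fin.cons a y)) fun x i b => ?_
      have := hF (Fin.cons a x) i.succ b
      rwa [← Fin.cons_update] at this
    refine (Finset.expect_le_expect fun a _ => h1 a).trans ?_
    rw [← Finset.expect_mul]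
    -- Averaging out the remaining coordinates keeps the oscillation in the first one at most `c`.
    have h2 := expect_exp_le (f := fun a => 𝔼 y : Fin m → Ω, F (Fin.cons a y)) hc (by
      intro a b
      rw [← Finset.expect_sub_distrib]
      refine (Finset.abs_expect_le _ _).trans (Finset.expect_le Finset.univ_nonempty fun y _ => ?_)
      have := hF (Fin.cons b y) 0 a
      rwa [Fin.update_cons_zero] at this)
    calc _ ≤ _ := mul_le_mul_of_nonneg_right h2 (Real.exp_pos _).le
      _ = _ := by rw [← Real.exp_add]; congr 1; push_cast; ring

/-- The lower tail of the bounded differences inequality. -/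
theorem card_lower_tail_le [Nonempty Ω] {c t : ℝ} (hc : 0 < c) (ht : 0 ≤ t) {m : ℕ} (hm : 0 < m)
    (F : (Fin m → Ω) → ℝ) (hF : ∀ x i a, |F (Function.update x i a) - F x| ≤ c) :
    ((Finset.univ.filter fun x => F x ≤ 𝔼 y, F y - t).card : ℝ) ≤
      (Fintype.card Ω : ℝ) ^ m * Real.exp (-(t ^ 2 / (2 * m * c ^ 2))) := by
  rcases ht.eq_or_lt with rfl | ht
  · simp only [ne_eq, OfNat.ofNat_ne_zero, not_false_eq_true, zero_pow, zero_div, neg_zero,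
      Real.exp_zero, mul_one]
    have := Finset.card_le_univ (Finset.univ.filter fun x => F x ≤ 𝔼 y, F y - 0)
    rw [Fintype.card_fun, Fintype.card_fin] at this
    exact_mod_cast this
  have hm' : (0 : ℝ) < m := by exact_mod_cast hm
  -- Chernoff parameter: the minimiser of `-l t + m l² c² / 2`.
  set l : ℝ := t / (m * c ^ 2) with hl
  have hl0 : 0 < l := by positivity
  have h1 := expect_exp_le_of_bounded_differences (c := l * c) (by positivity) m
    (fun x => -l * F x) (by
      intro x i a
      rw [← mul_sub, abs_mul, abs_neg, abs_of_pos hl0]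
      exact mul_le_mul_of_nonneg_left (hF x i a) hl0.le)
  rw [← Finset.mul_expect] at h1
  set S := Finset.univ.filter fun x => F x ≤ 𝔼 y, F y - t
  have h2 : (S.card : ℝ) * Real.exp (-l * (𝔼 y, F y - t)) ≤ ∑ x, Real.exp (-l * F x) := by
    rw [← nsmul_eq_mul]
    refine (Finset.card_nsmul_le_sum S (fun x => Real.exp (-l * F x)) _ fun x hx => ?_).trans
      (Finset.sum_le_univ_sum_of_nonneg fun x => (Real.exp_pos _).le)
    have := (Finset.mem_filter.1 hx).2
    apply Real.exp_le_exp.2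
    nlinarith
  rw [Fintype.expect_eq_sum_div_card, Fintype.card_fun, Fintype.card_fin] at h1
  push_cast at h1
  have hcard : (0 : ℝ) < (Fintype.card Ω : ℝ) ^ m :=
    pow_pos (by exact_mod_cast Fintype.card_pos) m
  rw [div_le_iff₀ hcard] at h1
  have h3 := h2.trans h1
  rw [← le_div_iff₀ (Real.exp_pos _), mul_comm, mul_div_assoc, ← Real.exp_sub] at h3
  refine h3.trans (le_of_eq ?_)
  congr 2
  rw [hl]
  field_simp
  ring

end Concentration

/-! ### A Lipschitz truncation of the absolute value. -/

/-- The tent function of height `R` supported on `R`-neighbourhoods of `±R`. -/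
def tent (R t : ℝ) : ℝ :=
  max 0 (min |t| (2 * R - |t|))

theorem tent_nonneg (R t : ℝ) : 0 ≤ tent R t := le_max_left _ _

theorem tent_sub_tent_le (R s t : ℝ) : |tent R s - tent R t| ≤ |s - t| := by
  unfold tent
  rw [max_comm, max_comm 0]
  refine (abs_max_sub_max_le_abs _ _ _).trans ?_
  refine (abs_min_sub_min_le_max _ _ _ _).trans (max_le (abs_abs_sub_abs_le _ _) ?_)
  rw [sub_sub_sub_cancel_left, abs_sub_comm]
  exact abs_abs_sub_abs_le _ _

theorem tent_le_abs {R : ℝ} (t : ℝ) : tent R t ≤ |t| :=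
  max_le (abs_nonneg t) (min_le_left _ _)

theorem tent_eq_zero {R t : ℝ} (h : 2 * R ≤ |t|) : tent R t = 0 :=
  max_eq_left ((min_le_right _ _).trans (by linarith))

/-- A polynomial minorant, so that a truncated first moment can be bounded below by second and
fourth moments. With `u = |t / R|`, the polynomial is below `u` on `[0, 1]`, below `2 - u` on `[1,
√2]`, and nonpositive afterwards. -/
theorem le_tent {R : ℝ} (hR : 0 < R) (t : ℝ) :
    R * ((t / R) ^ 2 - (t / R) ^ 4 / 2) ≤ tent R t := by
  have h1 : tent R t = R * max 0 (min |t / R| (2 - |t / R|)) := by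
    rw [tent, mul_max_of_nonneg _ _ hR.le, mul_min_of_nonneg _ _ hR.le, abs_div, abs_of_pos hR,
      mul_zero, mul_sub, mul_div_cancel₀ _ hR.ne', mul_comm R 2]
  rw [h1]
  refine mul_le_mul_of_nonneg_left ?_ hR.le
  have h2 : (t / R) ^ 2 = |t / R| ^ 2 := (sq_abs _).symm
  have h4 : (t / R) ^ 4 = |t / R| ^ 4 := by
    rw [show (4 : ℕ) = 2 * 2 from rfl, pow_mul, pow_mul, h2]
  rw [h2, h4]
  generalize hu : |t / R| = u
  have hu0 : 0 ≤ u := hu ▸ abs_nonneg _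
  rcases le_total u 1 with h | h
  · refine le_trans ?_ (le_max_right _ _)
    rw [min_eq_left (by linarith)]
    nlinarith [pow_nonneg hu0 4]
  · rcases le_total (u ^ 2) 2 with h' | h'
    · refine le_trans ?_ (le_max_right _ _)
      rw [min_eq_right (by linarith)]
      nlinarith [sq_nonneg (u ^ 2 - 3 / 2), sq_nonneg (u - 1)]
    · refine le_trans ?_ (le_max_left _ _)
      nlinarith

/-! ### Moments of sums of independent variables. -/

section Moments

variable {Ω : Type*} [Fintype Ω] [Nonempty Ω]

theorem expect_sum_apply (w : Ω → ℝ) (m : ℕ) :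
    𝔼 x : Fin m → Ω, ∑ i, w (x i) = m * 𝔼 a, w a := by
  induction m with
  | zero => simp
  | succ m ih =>
    rw [expect_cons]
    simp only [Fin.sum_univ_succ, Fin.cons_zero, Fin.cons_succ, Finset.expect_add_distrib,
      Fintype.expect_const, ih]
    push_cast
    ring

theorem expect_sum_apply_sq {w : Ω → ℝ} (hw : 𝔼 a, w a = 0) (m : ℕ) :
    𝔼 x : Fin m → Ω, (∑ i, w (x i)) ^ 2 = m * 𝔼 a, w a ^ 2 := by
  induction m with
  | zero => simp
  | succ m ih =>
    rw [expect_cons]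
    have h : ∀ a (y : Fin m → Ω), (∑ i, w ((Fin.cons a y : Fin (m + 1) → Ω) i)) ^ 2 =
        w a ^ 2 + (2 * w a * ∑ i, w (y i) + (∑ i, w (y i)) ^ 2) := by
      intro a y
      rw [Fin.sum_univ_succ]
      simp only [Fin.cons_zero, Fin.cons_succ]
      ring
    simp only [h, Finset.expect_add_distrib, Fintype.expect_const, ← Finset.mul_expect,
      expect_sum_apply, hw, mul_zero, ih, Finset.expect_const_zero]
    push_cast
    ring

theorem expect_sum_apply_pow_four_le {w : Ω → ℝ} (hw : 𝔼 a, w a = 0) (m : ℕ) :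
    𝔼 x : Fin m → Ω, (∑ i, w (x i)) ^ 4 ≤
      m * 𝔼 a, w a ^ 4 + 3 * m ^ 2 * (𝔼 a, w a ^ 2) ^ 2 := by
  induction m with
  | zero => simp
  | succ m ih =>
    rw [expect_cons]
    have h : ∀ a (y : Fin m → Ω), (∑ i, w ((Fin.cons a y : Fin (m + 1) → Ω) i)) ^ 4 =
        w a ^ 4 + (4 * w a ^ 3 * ∑ i, w (y i) + (6 * w a ^ 2 * (∑ i, w (y i)) ^ 2 +
          (4 * (∑ i, w (y i)) ^ 3 * w a + (∑ i, w (y i)) ^ 4))) := by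
      intro a y
      rw [Fin.sum_univ_succ]
      simp only [Fin.cons_zero, Fin.cons_succ]
      ring
    simp only [h, Finset.expect_add_distrib, Fintype.expect_const, ← Finset.mul_expect,
      ← Finset.expect_mul, expect_sum_apply, expect_sum_apply_sq hw, hw, mul_zero,
      Finset.expect_const_zero]
    push_cast
    nlinarith [sq_nonneg (𝔼 a, w a ^ 2)]

theorem expect_prod_apply {Ω : Type*} [Fintype Ω] (u : Ω → ℝ) (m : ℕ) :
    𝔼 x : Fin m → Ω, ∏ i, u (x i) = (𝔼 a, u a) ^ m := by
  induction m with
  | zero => simp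
  | succ m ih =>
    rw [expect_cons]
    simp only [Fin.prod_univ_succ, Fin.cons_zero, Fin.cons_succ, ← Finset.mul_expect, ih,
      ← Finset.expect_mul]
    ring

open Classical in
/-- The probability that exactly one coordinate lies in a given set. -/
theorem expect_exactly_one {Ω : Type*} [Fintype Ω] (S : Set Ω) (m : ℕ) :
    (𝔼 x : Fin m → Ω, if (∃! i, x i ∈ S) then (1 : ℝ) else 0) =
      m * (𝔼 a, if a ∈ S then (1 : ℝ) else 0) * (𝔼 a, if a ∈ S then (0 : ℝ) else 1) ^ (m - 1) := by
  induction m with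
  | zero => simp
  | succ m ih =>
    rw [expect_cons]
    have h : ∀ a (y : Fin m → Ω),
        (if (∃! i, (Fin.cons a y : Fin (m + 1) → Ω) i ∈ S) then (1 : ℝ) else 0) =
        (if a ∈ S then (1 : ℝ) else 0) * ∏ i, (if y i ∈ S then (0 : ℝ) else 1) +
          (if a ∈ S then (0 : ℝ) else 1) * (if (∃! i, y i ∈ S) then (1 : ℝ) else 0) := by
      intro a y
      by_cases ha : a ∈ S
      · have : (∃! i, (Fin.cons a y : Fin (m + 1) → Ω) i ∈ S) ↔ ∀ i, y i ∉ S := by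
          constructor
          · rintro ⟨j, -, hj⟩ i hi
            have h0 := hj 0 (by simpa using ha)
            have h1 := hj i.succ (by simpa using hi)
            exact Fin.succ_ne_zero i (h1.trans h0.symm)
          · intro h
            refine ⟨0, by simpa using ha, fun j hj => ?_⟩
            induction j using Fin.cases with
            | zero => rfl
            | succ i => exact absurd (by simpa using hj) (h i)
        simp only [this, ha, if_true, one_mul, zero_mul, add_zero]
        by_cases hall : ∀ i, y i ∉ S
        · simp [hall]
        · rw [if_neg hall]
          push Not at hall
          obtain ⟨i, hi⟩ := hall
          exact (Finset.prod_eq_zero (Finset.mem_univ i) (by simp [hi])).symm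
      · have : (∃! i, (Fin.cons a y : Fin (m + 1) → Ω) i ∈ S) ↔ ∃! i, y i ∈ S := by
          constructor
          · rintro ⟨j, hj, hu⟩
            induction j using Fin.cases with
            | zero => exact absurd (by simpa using hj) ha
            | succ i =>
              refine ⟨i, by simpa using hj, fun k hk => ?_⟩
              exact Fin.succ_injective _ (hu k.succ (by simpa using hk))
          · rintro ⟨i, hi, hu⟩
            refine ⟨i.succ, by simpa using hi, fun j hj => ?_⟩
            induction j using Fin.cases with
            | zero => exact absurd (by simpa using hj) ha
            | succ k => exact congrArg Fin.succ (hu k (by simpa using hj))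
        simp only [this, ha, if_false, one_mul, zero_mul, zero_add]
    have hp : (𝔼 y : Fin m → Ω, ∏ i, if y i ∈ S then (0 : ℝ) else 1) =
        (𝔼 a, if a ∈ S then (0 : ℝ) else 1) ^ m :=
      expect_prod_apply (fun a => if a ∈ S then (0 : ℝ) else 1) m
    simp only [h, Finset.expect_add_distrib, ← Finset.mul_expect, ← Finset.expect_mul, hp, ih]
    rcases m with _ | m
    · simp
    · push_cast
      ring

/-- By `le_tent`, the mean is at least `R (E X² / R² - E X⁴ / (2 R⁴))`. Here `E X² ≥ s` and `E X⁴ ≤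
2s + 12s² ≤ 14s²`, so `R² = 16s` leaves `1/16 - 7/256 ≥ 1/32`. -/
theorem le_expect_tent_sum {w : Ω → ℝ} (hw : 𝔼 a, w a = 0) (hw1 : ∀ a, |w a| ≤ 1) (m : ℕ)
    {s R : ℝ} (hR : 0 < R) (hs : 1 ≤ s) (hRs : R ^ 2 = 16 * s) (h1 : s ≤ m * 𝔼 a, w a ^ 2)
    (h2 : m * 𝔼 a, w a ^ 2 ≤ 2 * s) :
    R / 32 ≤ 𝔼 x : Fin m → Ω, tent R (∑ i, w (x i)) := by
  have h4 : 𝔼 a, w a ^ 4 ≤ 𝔼 a, w a ^ 2 := Finset.expect_le_expect fun a _ => by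
    have := (sq_le_one_iff_abs_le_one (w a)).2 (hw1 a)
    nlinarith [sq_nonneg (w a)]
  have hp4 := expect_sum_apply_pow_four_le hw m
  have hm : (0 : ℝ) ≤ m := Nat.cast_nonneg m
  have hp4' : 𝔼 x : Fin m → Ω, (∑ i, w (x i)) ^ 4 ≤ 14 * s ^ 2 := by
    have := mul_le_mul_of_nonneg_left h4 hm
    have h0 : (0 : ℝ) ≤ m * 𝔼 a, w a ^ 2 := by linarith
    nlinarith
  have hR4 : R ^ 4 = 256 * s ^ 2 := by
    rw [show (4 : ℕ) = 2 * 2 from rfl, pow_mul, hRs]; ring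
  calc R / 32 ≤ R * ((m * 𝔼 a, w a ^ 2) / R ^ 2 -
        (𝔼 x : Fin m → Ω, (∑ i, w (x i)) ^ 4) / R ^ 4 / 2) := by
        rw [div_eq_mul_inv]
        refine mul_le_mul_of_nonneg_left ?_ hR.le
        have e1 : (1 : ℝ) / 16 ≤ (m * 𝔼 a, w a ^ 2) / R ^ 2 := by
          rw [hRs, le_div_iff₀ (by linarith)]; linarith
        have e2 : (𝔼 x : Fin m → Ω, (∑ i, w (x i)) ^ 4) / R ^ 4 ≤ 14 / 256 := by
          rw [hR4, div_le_iff₀ (by positivity)]; linarith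
        linarith
    _ = 𝔼 x : Fin m → Ω, R * (((∑ i, w (x i)) / R) ^ 2 - ((∑ i, w (x i)) / R) ^ 4 / 2) := by
        simp only [div_pow, ← Finset.mul_expect, Finset.expect_sub_distrib, ← Finset.expect_div,
          expect_sum_apply_sq hw]
    _ ≤ _ := Finset.expect_le_expect fun x _ => le_tent hR _

end Moments

/-! ### Exponential sums and differenced phases. -/

section Trigonometric

theorem cos_two_pi_mul_le (t : ℝ) :
    Real.cos (2 * Real.pi * t) ≤ 1 - 8 * ‖(t : UnitAddCircle)‖ ^ 2 := by
  rw [UnitAddCircle.norm_eq, sq_abs]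
  have h := abs_sub_round t
  have e : Real.cos (2 * Real.pi * t) = Real.cos (2 * Real.pi * (t - round t)) := by
    rw [← Real.cos_sub_int_mul_two_pi _ (round t)]
    congr 1
    ring
  rw [e]
  refine (Real.cos_le_one_sub_mul_cos_sq ?_).trans (le_of_eq ?_)
  · rw [abs_mul, abs_of_pos Real.two_pi_pos]
    nlinarith [Real.pi_pos]
  · have := Real.pi_ne_zero
    field_simp
    ring

theorem expCircle_mul_exp (x θ : ℝ) :
    (expCircle x * Complex.exp (-(2 * Real.pi * θ : ℝ) * Complex.I)).re =
      Real.cos (2 * Real.pi * (x - θ)) := by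
  rw [expCircle, ← Complex.exp_add]
  have : (2 * Real.pi * Complex.I * x + -(2 * Real.pi * θ : ℝ) * Complex.I : ℂ) =
      ((2 * Real.pi * (x - θ) : ℝ) : ℂ) * Complex.I := by
    push_cast
    ring
  rw [this, Complex.exp_ofReal_mul_I_re]

/-- Taking `2πθ` to be the argument of the sum makes its modulus equal to `∑ cos (2π (x_j - θ))`. -/
theorem exists_norm_sum_expCircle_le {ι : Type*} (s : Finset ι) (x : ι → ℝ) :
    ∃ θ : ℝ, ‖∑ j ∈ s, expCircle (x j)‖ ≤
      s.card - 8 * ∑ j ∈ s, ‖((x j - θ : ℝ) : UnitAddCircle)‖ ^ 2 := by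
  set z := ∑ j ∈ s, expCircle (x j) with hz
  refine ⟨z.arg / (2 * Real.pi), ?_⟩
  set θ := z.arg / (2 * Real.pi) with hθ
  have harg : 2 * Real.pi * θ = z.arg := mul_div_cancel₀ _ Real.two_pi_pos.ne'
  have h1 : (z * Complex.exp (-(2 * Real.pi * θ : ℝ) * Complex.I)).re = ‖z‖ := by
    rw [harg]
    nth_rewrite 1 [← Complex.norm_mul_exp_arg_mul_I z]
    rw [mul_assoc, ← Complex.exp_add]
    simp
  rw [← h1, hz, Finset.sum_mul, Complex.re_sum]
  simp only [expCircle_mul_exp]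
  calc _ ≤ ∑ j ∈ s, (1 - 8 * ‖((x j - θ : ℝ) : UnitAddCircle)‖ ^ 2) :=
        Finset.sum_le_sum fun j _ => cos_two_pi_mul_le _
    _ = _ := by rw [Finset.sum_sub_distrib, ← Finset.mul_sum]; simp

theorem sum_shift_le {f : ℕ → ℝ} (hf : ∀ j, 0 ≤ f j) {m h n : ℕ} (hmn : m + h ≤ n) :
    ∑ j ∈ Finset.Icc 1 m, f (j + h) ≤ ∑ j ∈ Finset.Icc 1 n, f j := by
  have := Finset.sum_map (Finset.Icc 1 m) (addRightEmbedding h) f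
  simp only [addRightEmbedding_apply] at this
  rw [← this]
  refine Finset.sum_le_sum_of_subset_of_nonneg ?_ fun j _ _ => hf j
  intro j hj
  simp only [Finset.mem_map, Finset.mem_Icc, addRightEmbedding_apply] at hj ⊢
  obtain ⟨k, hk, rfl⟩ := hj
  omega

/-- The coefficients `1, -2, 1` sum to zero, so `θ` cancels. Cauchy–Schwarz costs `1 + 4 + 1 = 6`
and the three shifted sums cost `3`, whence `8 / 18 = 4/9`. -/
theorem norm_sum_expCircle_le_of_second_difference (x : ℕ → ℝ) {m L n : ℕ} (h : m + 2 * L ≤ n) :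
    ‖∑ j ∈ Finset.Icc 1 n, expCircle (x j)‖ ≤ n - 4 / 9 * ∑ j ∈ Finset.Icc 1 m,
      ‖((x j - 2 * x (j + L) + x (j + 2 * L) : ℝ) : UnitAddCircle)‖ ^ 2 := by
  obtain ⟨θ, hθ⟩ := exists_norm_sum_expCircle_le (Finset.Icc 1 n) x
  rw [Nat.card_Icc, Nat.add_sub_cancel] at hθ
  set u : ℕ → ℝ := fun j => ‖((x j - θ : ℝ) : UnitAddCircle)‖ with hu
  have h1 : ∀ j, ‖((x j - 2 * x (j + L) + x (j + 2 * L) : ℝ) : UnitAddCircle)‖ ^ 2 ≤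
      6 * (u j ^ 2 + u (j + L) ^ 2 + u (j + 2 * L) ^ 2) := by
    intro j
    have e : ((x j - 2 * x (j + L) + x (j + 2 * L) : ℝ) : UnitAddCircle) =
        ((x j - θ : ℝ) : UnitAddCircle) - ((x (j + L) - θ : ℝ) : UnitAddCircle)
          - ((x (j + L) - θ : ℝ) : UnitAddCircle) + ((x (j + 2 * L) - θ : ℝ) : UnitAddCircle) := by
      rw [← AddCircle.coe_sub, ← AddCircle.coe_sub, ← AddCircle.coe_add]
      congr 1
      ring
    have h2 : ‖((x j - 2 * x (j + L) + x (j + 2 * L) : ℝ) : UnitAddCircle)‖ ≤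
        u j + u (j + L) + u (j + L) + u (j + 2 * L) := by
      rw [e]
      refine (norm_add_le _ _).trans (add_le_add_left ?_ _)
      refine (norm_sub_le _ _).trans (add_le_add_left ?_ _)
      exact norm_sub_le _ _
    have h3 := pow_le_pow_left₀ (norm_nonneg _) h2 2
    nlinarith [sq_nonneg (2 * u j - u (j + L)), sq_nonneg (u j - u (j + 2 * L)),
      sq_nonneg (2 * u (j + 2 * L) - u (j + L))]
  have h4 := Finset.sum_le_sum fun j (_ : j ∈ Finset.Icc 1 m) => h1 j
  rw [← Finset.mul_sum, Finset.sum_add_distrib, Finset.sum_add_distrib] at h4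
  have hf : ∀ j, 0 ≤ u j ^ 2 := fun j => sq_nonneg _
  have s0 := sum_shift_le hf (m := m) (h := 0) (n := n) (by omega)
  have s1 := sum_shift_le hf (m := m) (h := L) (n := n) (by omega)
  have s2 := sum_shift_le hf h
  simp only [add_zero] at s0
  linarith

theorem norm_sum_expCircle_le_of_difference (x : ℕ → ℝ) {m h n : ℕ} (hmn : m + h ≤ n) :
    ‖∑ j ∈ Finset.Icc 1 n, expCircle (x j)‖ ≤ n - 2 * ∑ j ∈ Finset.Icc 1 m,
      ‖((x (j + h) - x j : ℝ) : UnitAddCircle)‖ ^ 2 := by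
  obtain ⟨θ, hθ⟩ := exists_norm_sum_expCircle_le (Finset.Icc 1 n) x
  rw [Nat.card_Icc, Nat.add_sub_cancel] at hθ
  set u : ℕ → ℝ := fun j => ‖((x j - θ : ℝ) : UnitAddCircle)‖ with hu
  have h1 : ∀ j, ‖((x (j + h) - x j : ℝ) : UnitAddCircle)‖ ^ 2 ≤
      2 * (u (j + h) ^ 2 + u j ^ 2) := by
    intro j
    have e : ((x (j + h) - x j : ℝ) : UnitAddCircle) =
        ((x (j + h) - θ : ℝ) : UnitAddCircle) - ((x j - θ : ℝ) : UnitAddCircle) := by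
      rw [← AddCircle.coe_sub]
      congr 1
      ring
    have h2 : ‖((x (j + h) - x j : ℝ) : UnitAddCircle)‖ ≤ u (j + h) + u j := by
      rw [e]
      exact norm_sub_le _ _
    have h3 := pow_le_pow_left₀ (norm_nonneg _) h2 2
    nlinarith [sq_nonneg (u (j + h) - u j)]
  have h4 := Finset.sum_le_sum fun j (_ : j ∈ Finset.Icc 1 m) => h1 j
  rw [← Finset.mul_sum, Finset.sum_add_distrib] at h4
  have hf : ∀ j, 0 ≤ u j ^ 2 := fun j => sq_nonneg _
  have s0 := sum_shift_le hf (m := m) (h := 0) (n := n) (by omega)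
  have s1 := sum_shift_le hf hmn
  simp only [add_zero] at s0
  linarith

theorem norm_coe_unitAddCircle_eq_abs {t : ℝ} (h : |t| ≤ 1 / 2) :
    ‖(t : UnitAddCircle)‖ = |t| :=
  (AddCircle.norm_coe_eq_abs_iff (p := 1) one_ne_zero).2 (by simpa using h)

end Trigonometric

/-! ### From the characteristic function to an exponential sum. -/

section CharacteristicFunction

theorem integral_uniformOn_finset {α : Type*} [MeasurableSpace α] [MeasurableSingletonClass α]
    (s : Finset α) (f : α → ℂ) :
    ∫ x, f x ∂(uniformOn (s : Set α)) = (s.card : ℂ)⁻¹ * ∑ x ∈ s, f x := by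
  rw [uniformOn, ProbabilityTheory.cond, integral_smul_measure, Measure.count_apply_finset,
    setIntegral_finset]
  · simp [Measure.real]
  · rw [← (s : Set α).biUnion_of_singleton]
    simp [integrableOn_finset_iUnion]

theorem charFn_eq {n : ℕ} (a : Fin n → ℕ) (α β : ℝ) :
    charFn a α β = (n : ℂ)⁻¹ * ∑ j ∈ Finset.Icc 1 n,
      expCircle (α * dev a j + β * ((j : ℝ) - ((n : ℝ) + 1) / 2)) := by
  rw [charFn, lawUV, integral_map (Measurable.of_discrete).aemeasurable]
  · have : (Set.Icc 1 n : Set ℕ) = ((Finset.Icc 1 n : Finset ℕ) : Set ℕ) := by simp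
    rw [this, integral_uniformOn_finset, Nat.card_Icc, Nat.add_sub_cancel]
    rfl
  · refine Continuous.aestronglyMeasurable ?_
    unfold expCircle
    fun_prop

theorem norm_charFn_pow_le {n : ℕ} (hn : 1 ≤ n) (a : Fin n → ℕ) (α β : ℝ)
    (h : ‖∑ j ∈ Finset.Icc 1 n, expCircle (α * dev a j + β * ((j : ℝ) - ((n : ℝ) + 1) / 2))‖ ≤
      n - 10 * Real.log n) :
    ‖charFn a α β‖ ^ n ≤ (n : ℝ) ^ (-10 : ℤ) := by
  have hn0 : (0 : ℝ) < n := by exact_mod_cast hn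
  have h1 : ‖charFn a α β‖ ≤ Real.exp (-(10 * Real.log n / n)) := by
    rw [charFn_eq, norm_mul, norm_inv, Complex.norm_natCast, inv_mul_le_iff₀ hn0]
    refine h.trans ?_
    have := Real.add_one_le_exp (-(10 * Real.log n / n))
    calc (n : ℝ) - 10 * Real.log n = n * (-(10 * Real.log n / n) + 1) := by field_simp; ring
      _ ≤ _ := mul_le_mul_of_nonneg_left this hn0.le
  refine (pow_le_pow_left₀ (norm_nonneg _) h1 n).trans (le_of_eq ?_)
  rw [← Real.exp_nat_mul, ← Real.rpow_intCast, Real.rpow_def_of_pos hn0]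
  congr 1
  push_cast
  field_simp

end CharacteristicFunction

/-! ### Unimodality of the sum of uniform variables. -/

section Counting

/-- The number of vectors in `{0, …, n - 1} ^ m` with coordinate sum `s`. -/
def sumCount (n m : ℕ) (s : ℤ) : ℕ :=
  (Finset.univ.filter fun x : Fin m → Fin n => (∑ i, ((x i : ℕ) : ℤ)) = s).card

theorem sumCount_eq_sum (n m : ℕ) (s : ℤ) :
    sumCount n m s = ∑ x : Fin m → Fin n, if (∑ i, ((x i : ℕ) : ℤ)) = s then 1 else 0 := by
  rw [sumCount, Finset.card_filter]

theorem sumCount_succ (n m : ℕ) (s : ℤ) :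
    sumCount n (m + 1) s = ∑ k ∈ Finset.range n, sumCount n m (s - k) := by
  rw [Finset.sum_range, sumCount_eq_sum,
    ← (Fin.consEquiv fun _ : Fin (m + 1) => Fin n).sum_comp, Fintype.sum_prod_type]
  refine Finset.sum_congr rfl fun a _ => ?_
  rw [sumCount_eq_sum]
  refine Finset.sum_congr rfl fun y _ => ?_
  have : (∑ i, (((Fin.consEquiv fun _ : Fin (m + 1) => Fin n) (a, y) i : ℕ) : ℤ)) =
      (a : ℕ) + ∑ i, ((y i : ℕ) : ℤ) := by
    rw [Fin.sum_univ_succ]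
    rfl
  rw [this]
  congr 1
  exact propext ⟨fun h => by linarith, fun h => by linarith⟩

theorem sumCount_symm (n m : ℕ) (s : ℤ) :
    sumCount n m (m * ((n : ℤ) - 1) - s) = sumCount n m s := by
  rw [sumCount_eq_sum, sumCount_eq_sum,
    ← (Equiv.arrowCongr (Equiv.refl (Fin m)) (Fin.revPerm (n := n))).sum_comp]
  refine Finset.sum_congr rfl fun x _ => ?_
  have : (∑ i, (((Equiv.arrowCongr (Equiv.refl (Fin m)) (Fin.revPerm (n := n)) x) i : ℕ) : ℤ)) =
      m * ((n : ℤ) - 1) - ∑ i, ((x i : ℕ) : ℤ) := by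
    rw [eq_sub_iff_add_eq, ← Finset.sum_add_distrib]
    have : ∀ i, (((Equiv.arrowCongr (Equiv.refl (Fin m)) (Fin.revPerm (n := n)) x) i : ℕ) : ℤ) +
        ((x i : ℕ) : ℤ) = (n : ℤ) - 1 := by
      intro i
      have h := (x i).2
      simp only [Equiv.arrowCongr_apply, Function.comp_apply, Equiv.refl_symm, Equiv.refl_apply,
        Fin.revPerm_apply, Fin.val_rev]
      omega
    rw [Finset.sum_congr rfl fun i _ => this i]
    simp
    ring
  rw [this]
  congr 1
  exact propext ⟨fun h => by linarith, fun h => by linarith⟩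

/-- `sumCount n (m + 1)` is a sum over a window of length `n`; moving it by one adds one term and
drops another. -/
theorem sumCount_succ_add_one (n m : ℕ) (s : ℤ) :
    sumCount n (m + 1) (s + 1) + sumCount n m (s + 1 - n) =
      sumCount n (m + 1) s + sumCount n m (s + 1) := by
  have e : ∀ k : ℕ, s + 1 - ((k + 1 : ℕ) : ℤ) = s - k := fun k => by push_cast; ring
  have h1 := Finset.sum_range_succ (fun k : ℕ => sumCount n m (s + 1 - k)) n
  have h2 := Finset.sum_range_succ' (fun k : ℕ => sumCount n m (s + 1 - k)) n
  simp only [e, Nat.cast_zero, sub_zero] at h2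
  rw [sumCount_succ, sumCount_succ, ← h1, h2]

/-- A function on the integers that is symmetric about `c / 2` and nondecreasing to its left is
a nonincreasing function of the distance to `c / 2`. -/
theorem le_of_symm_of_step {f : ℤ → ℕ} {c : ℤ} (hs : ∀ s, f (c - s) = f s)
    (hstep : ∀ s, 2 * (s + 1) ≤ c + 1 → f s ≤ f (s + 1)) {s t : ℤ}
    (h : |2 * s - c| ≤ |2 * t - c|) : f t ≤ f s := by
  have mono : ∀ (d : ℕ) (u : ℤ), 2 * (u + d) ≤ c + 1 → f u ≤ f (u + d) := by
    intro d
    induction d with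
    | zero => simp
    | succ d ih =>
      intro u hu
      push_cast at hu ⊢
      rw [← add_assoc]
      exact (ih u (by omega)).trans (hstep _ (by omega))
  have left : ∀ u, ∃ v, f v = f u ∧ 2 * v ≤ c ∧ c - 2 * v = |2 * u - c| := by
    intro u
    rcases le_total (2 * u) c with hu | hu
    · exact ⟨u, rfl, hu, by rw [abs_of_nonpos (by omega)]; ring⟩
    · exact ⟨c - u, hs u, by omega, by rw [abs_of_nonneg (by omega)]; ring⟩
  obtain ⟨s', hs1, hs2, hs3⟩ := left s
  obtain ⟨t', ht1, ht2, ht3⟩ := left t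
  rw [← hs1, ← ht1]
  have := mono (s' - t').toNat t' (by omega)
  rwa [show t' + ((s' - t').toNat : ℤ) = s' by omega] at this

theorem sumCount_le_sumCount (n : ℕ) : ∀ (m : ℕ) {s t : ℤ},
    |2 * s - m * ((n : ℤ) - 1)| ≤ |2 * t - m * ((n : ℤ) - 1)| →
      sumCount n m t ≤ sumCount n m s := by
  intro m
  induction m with
  | zero =>
    intro s t h
    refine le_of_symm_of_step (c := (0 : ℕ) * ((n : ℤ) - 1)) (sumCount_symm n 0) ?_ h
    intro s hs
    have h0 : sumCount n 0 s = 0 := by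
      rw [sumCount, Finset.card_eq_zero, Finset.filter_eq_empty_iff]
      intro x _
      simp only [Finset.univ_eq_empty, Finset.sum_empty]
      push_cast at hs
      omega
    rw [h0]
    exact Nat.zero_le _
  | succ m ih =>
    intro s t h
    refine le_of_symm_of_step (c := (m + 1 : ℕ) * ((n : ℤ) - 1)) (sumCount_symm n (m + 1)) ?_ h
    intro s hs
    have h1 := sumCount_succ_add_one n m s
    -- The midpoint of `s + 1 - n` and `s + 1` is not past the centre for `m` summands, so `s + 1`
    -- is at least as close to that centre.
    have h2 : sumCount n m (s + 1 - n) ≤ sumCount n m (s + 1) := by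
      apply ih
      push_cast at hs
      generalize hq : (m : ℤ) * ((n : ℤ) - 1) = q at *
      have : 2 * (s + 1) ≤ q + n := by linarith
      rcases abs_cases (2 * (s + 1) - q) with h | h <;>
        rcases abs_cases (2 * (s + 1 - n) - q) with h' | h' <;> omega
    omega

/-- Pigeonhole: the `n^n` vectors have sums in `[0, n²)`, and no fibre is larger than the central
one. -/
theorem pow_le_sq_mul_sumCount {n : ℕ} (hn : 1 ≤ n) {s : ℤ} (hs : 2 * s = n * ((n : ℤ) - 1)) :
    n ^ n ≤ n ^ 2 * sumCount n n s := by
  have hmap : ∀ x ∈ (Finset.univ : Finset (Fin n → Fin n)),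
      ∑ i, (x i : ℕ) ∈ Finset.range (n ^ 2) := by
    intro x _
    rw [Finset.mem_range]
    have : ∑ i, (x i : ℕ) < ∑ _i : Fin n, n :=
      Finset.sum_lt_sum_of_nonempty ⟨⟨0, hn⟩, Finset.mem_univ _⟩ fun i _ => (x i).2
    simpa [sq] using this
  have h1 := Finset.card_eq_sum_card_fiberwise hmap
  rw [Finset.card_univ, Fintype.card_fun, Fintype.card_fin] at h1
  rw [h1]
  have h2 : ∀ b ∈ Finset.range (n ^ 2),
      (Finset.univ.filter fun x : Fin n → Fin n => ∑ i, (x i : ℕ) = b).card ≤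
        sumCount n n s := by
    intro b _
    refine le_trans (le_of_eq ?_) (sumCount_le_sumCount n n (s := s) (t := b) ?_)
    · rw [sumCount]
      congr 1
      ext x
      simp only [Finset.mem_filter]
      norm_cast
    · rw [hs, sub_self, abs_zero]
      exact abs_nonneg _
  refine (Finset.sum_le_card_nsmul _ _ _ h2).trans (le_of_eq ?_)
  simp

end Counting

/-! ### The contribution of one side to second differences. -/

section Weights

/-- The contribution of a side with value `k` to `f_A(j)`. -/
noncomputable def halfStep (j k : ℕ) : ℝ :=
  if k < j then 1 else if k = j then 1 / 2 else 0

theorem cumul_eq_sum {n : ℕ} (a : Fin n → ℕ) (j : ℕ) : cumul a j = ∑ i, halfStep j (a i) := by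
  have : ∀ i, halfStep j (a i) =
      (if a i < j then 1 else 0) + 1 / 2 * (if a i = j then 1 else 0) := by
    intro i
    unfold halfStep
    split_ifs <;> first | omega | norm_num
  simp only [this, cumul, Finset.sum_add_distrib, ← Finset.mul_sum, Finset.card_filter]
  push_cast
  rfl

theorem sum_fin_succ_eq_sum_Icc (n : ℕ) (f : ℕ → ℝ) :
    ∑ k : Fin n, f (k + 1) = ∑ k ∈ Finset.Icc 1 n, f k := by
  rw [← Finset.sum_range fun k => f (k + 1), Finset.range_eq_Ico,
    Finset.sum_Ico_add' (fun k => f k) 0 n 1]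
  rfl

theorem sum_halfStep {n j : ℕ} (h1 : 1 ≤ j) (hn : j ≤ n) :
    ∑ k : Fin n, halfStep j (k + 1) = j - 1 / 2 := by
  rw [sum_fin_succ_eq_sum_Icc n (halfStep j)]
  have : ∀ k, halfStep j k =
      (if k < j then 1 else 0) + 1 / 2 * (if k = j then 1 else 0) := by
    intro k
    unfold halfStep
    split_ifs <;> first | omega | norm_num
  simp only [this, Finset.sum_add_distrib, ← Finset.mul_sum]
  rw [Finset.sum_ite_eq' , if_pos (Finset.mem_Icc.2 ⟨h1, hn⟩), Finset.sum_boole]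
  have : (Finset.Icc 1 n).filter (fun k => k < j) = Finset.Ico 1 j := by
    ext k
    simp only [Finset.mem_filter, Finset.mem_Icc, Finset.mem_Ico]
    omega
  rw [this, Nat.card_Ico, Nat.cast_sub h1]
  push_cast
  ring

/-- The contribution of a side with value `k` to `g_A(j) - 2 g_A(j + L) + g_A(j + 2 L)`. -/
noncomputable def secondDiff (L j k : ℕ) : ℝ :=
  halfStep j k - 2 * halfStep (j + L) k + halfStep (j + 2 * L) k

theorem dev_second_difference {n : ℕ} (a : Fin n → ℕ) (L j : ℕ) :
    dev a j - 2 * dev a (j + L) + dev a (j + 2 * L) = ∑ i, secondDiff L j (a i) := by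
  simp only [dev, cumul_eq_sum, secondDiff, Finset.sum_add_distrib, Finset.sum_sub_distrib,
    ← Finset.mul_sum]
  push_cast
  ring

theorem abs_secondDiff_le (L j k : ℕ) : |secondDiff L j k| ≤ 1 := by
  unfold secondDiff halfStep
  split_ifs <;> first | omega | norm_num [abs_le]

theorem secondDiff_eq_zero {L j k : ℕ} (h : ¬(j ≤ k ∧ k ≤ j + 2 * L)) : secondDiff L j k = 0 := by
  unfold secondDiff halfStep
  split_ifs <;> first | omega | norm_num

/-- The sum of `halfStep j` over the sides is affine in `j`, so its second difference vanishes. -/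
theorem sum_secondDiff {n L j : ℕ} (h1 : 1 ≤ j) (hn : j + 2 * L ≤ n) :
    ∑ k : Fin n, secondDiff L j (k + 1) = 0 := by
  simp only [secondDiff, Finset.sum_add_distrib, Finset.sum_sub_distrib, ← Finset.mul_sum]
  rw [sum_halfStep h1 (by omega), sum_halfStep (by omega) (by omega),
    sum_halfStep (by omega) hn]
  push_cast
  ring

theorem sum_secondDiff_sq_le {n L j : ℕ} :
    ∑ k : Fin n, secondDiff L j (k + 1) ^ 2 ≤ 2 * L := by
  rw [sum_fin_succ_eq_sum_Icc n fun k => secondDiff L j k ^ 2]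
  have : ∀ k, secondDiff L j k ^ 2 ≤ (if k ∈ Finset.Ico j (j + L) then 1 else 0) +
      (if k ∈ Finset.Ioc (j + L) (j + 2 * L) then 1 else 0) := by
    intro k
    unfold secondDiff halfStep
    simp only [Finset.mem_Ico, Finset.mem_Ioc]
    split_ifs <;> first | omega | norm_num
  refine (Finset.sum_le_sum fun k _ => this k).trans ?_
  rw [Finset.sum_add_distrib, Finset.sum_boole, Finset.sum_boole]
  have h1 : ((Finset.Icc 1 n).filter fun k => k ∈ Finset.Ico j (j + L)).card ≤ L := by
    refine (Finset.card_le_card fun k hk => (Finset.mem_filter.1 hk).2).trans ?_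
    simp
  have h2 : ((Finset.Icc 1 n).filter fun k => k ∈ Finset.Ioc (j + L) (j + 2 * L)).card ≤ L := by
    refine (Finset.card_le_card fun k hk => (Finset.mem_filter.1 hk).2).trans ?_
    simp only [Nat.card_Ioc]
    omega
  have : (((Finset.Icc 1 n).filter fun k => k ∈ Finset.Ico j (j + L)).card +
    ((Finset.Icc 1 n).filter fun k => k ∈ Finset.Ioc (j + L) (j + 2 * L)).card : ℝ) ≤ L + L := by
    exact_mod_cast add_le_add h1 h2
  linarith

/-- The weight is `-1` strictly between `j` and `j + L` and `1` strictly between `j + L` and `j +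
2L`: that is `2(L - 1) ≥ L` unit squares. At `L = 1` both intervals are empty. -/
theorem le_sum_secondDiff_sq {n L j : ℕ} (hL : 2 ≤ L) (hn : j + 2 * L ≤ n) :
    (L : ℝ) ≤ ∑ k : Fin n, secondDiff L j (k + 1) ^ 2 := by
  rw [sum_fin_succ_eq_sum_Icc n fun k => secondDiff L j k ^ 2]
  have : ∀ k, (if k ∈ Finset.Ioo j (j + L) ∪ Finset.Ioo (j + L) (j + 2 * L) then 1 else 0) ≤
      secondDiff L j k ^ 2 := by
    intro k
    unfold secondDiff halfStep
    simp only [Finset.mem_union, Finset.mem_Ioo]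
    split_ifs <;> first | omega | norm_num
  refine le_trans ?_ (Finset.sum_le_sum fun k _ => this k)
  rw [Finset.sum_boole]
  have h2 : Finset.Ioo j (j + L) ∪ Finset.Ioo (j + L) (j + 2 * L) ⊆
      (Finset.Icc 1 n).filter
        fun k => k ∈ Finset.Ioo j (j + L) ∪ Finset.Ioo (j + L) (j + 2 * L) := by
    intro k hk
    refine Finset.mem_filter.2 ⟨?_, hk⟩
    simp only [Finset.mem_union, Finset.mem_Ioo, Finset.mem_Icc] at hk ⊢
    omega
  have h3 := Finset.card_le_card h2
  rw [Finset.card_union_of_disjoint, Nat.card_Ioo, Nat.card_Ioo] at h3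
  · have : L ≤ j + L - j - 1 + (j + 2 * L - (j + L) - 1) := by omega
    exact_mod_cast this.trans h3
  · rw [Finset.disjoint_left]
    intro k
    simp only [Finset.mem_Ioo]
    omega

end Weights

/-! ### Typical size of `g_A` and of its second differences. -/

section Fluctuations

theorem sum_update_sub_sum {Ω : Type*} (w : Ω → ℝ) {m : ℕ} (x : Fin m → Ω) (i : Fin m) (a : Ω) :
    ∑ k, w (Function.update x i a k) - ∑ k, w (x k) = w a - w (x i) := by
  rw [← Finset.add_sum_erase _ _ (Finset.mem_univ i),
    ← Finset.add_sum_erase Finset.univ (fun k => w (x k)) (Finset.mem_univ i),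
    Function.update_self]
  have : ∑ k ∈ Finset.univ.erase i, w (Function.update x i a k) =
      ∑ k ∈ Finset.univ.erase i, w (x k) :=
    Finset.sum_congr rfl fun k hk => by rw [Function.update_of_ne (Finset.ne_of_mem_erase hk)]
  rw [this]
  ring

/-- The sequence of values in `{1, …, n}` encoded by a vector of `Fin n`. -/
def toDie {n : ℕ} (x : Fin n → Fin n) : Fin n → ℕ := fun i => x i + 1

theorem expect_dev {n j : ℕ} (h1 : 1 ≤ j) (hn : j ≤ n) :
    𝔼 x : Fin n → Fin n, dev (toDie x) j = 0 := by
  have : Nonempty (Fin n) := ⟨⟨0, by omega⟩⟩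
  have hn0 : (n : ℝ) ≠ 0 := by exact_mod_cast (by omega : n ≠ 0)
  simp only [dev, cumul_eq_sum, Finset.expect_add_distrib, Finset.expect_sub_distrib,
    Fintype.expect_const, toDie]
  rw [expect_sum_apply (fun k : Fin n => halfStep j (k + 1)), Fintype.expect_eq_sum_div_card,
    sum_halfStep h1 hn, Fintype.card_fin]
  field_simp
  ring

theorem card_le_abs_dev {n j : ℕ} (h1 : 1 ≤ j) (hn : j ≤ n) {t : ℝ} (ht : 0 ≤ t) :
    ((Finset.univ.filter fun x : Fin n → Fin n => t ≤ |dev (toDie x) j|).card : ℝ) ≤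
      2 * (n : ℝ) ^ n * Real.exp (-(t ^ 2 / (2 * n))) := by
  have : Nonempty (Fin n) := ⟨⟨0, by omega⟩⟩
  have hE := expect_dev h1 hn
  have hF : ∀ (x : Fin n → Fin n) i a,
      |dev (toDie (Function.update x i a)) j - dev (toDie x) j| ≤ 1 := by
    intro x i a
    have := sum_update_sub_sum (fun k : Fin n => halfStep j (k + 1)) x i a
    simp only [dev, cumul_eq_sum, toDie]
    rw [add_sub_add_right_eq_sub, sub_sub_sub_cancel_right, this]
    unfold halfStep
    split_ifs <;> norm_num [abs_le]
  have hlow := card_lower_tail_le (m := n) one_pos ht (by omega) (fun x => dev (toDie x) j) hF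
  have hup := card_lower_tail_le (m := n) one_pos ht (by omega) (fun x => -dev (toDie x) j) (by
    intro x i a
    rw [neg_sub_neg, abs_sub_comm]
    exact hF x i a)
  rw [Finset.expect_neg_distrib] at hup
  simp only [hE, neg_zero, zero_sub, Fintype.card_fin, one_pow, mul_one, neg_le_neg_iff]
    at hlow hup
  have hsub : (Finset.univ.filter fun x : Fin n → Fin n => t ≤ |dev (toDie x) j|) ⊆
      (Finset.univ.filter fun x : Fin n → Fin n => dev (toDie x) j ≤ -t) ∪
        (Finset.univ.filter fun x : Fin n → Fin n => t ≤ dev (toDie x) j) := by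
    intro x hx
    simp only [Finset.mem_union, Finset.mem_filter, Finset.mem_univ, true_and] at hx ⊢
    rcases le_abs.1 hx with h | h
    · exact Or.inr h
    · exact Or.inl (by linarith)
  have h3 : ((Finset.univ.filter fun x : Fin n → Fin n => t ≤ |dev (toDie x) j|).card : ℝ) ≤
      (Finset.univ.filter fun x : Fin n → Fin n => dev (toDie x) j ≤ -t).card +
        (Finset.univ.filter fun x : Fin n → Fin n => t ≤ dev (toDie x) j).card := by
    exact_mod_cast (Finset.card_le_card hsub).trans (Finset.card_union_le _ _)
  linarith

/-- The total truncated second difference of `g_A` at scale `L`. -/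
noncomputable def fluctuation (n L : ℕ) (R : ℝ) (a : Fin n → ℕ) : ℝ :=
  ∑ j ∈ Finset.Icc 1 (n - 2 * L), tent R (∑ i, secondDiff L j (a i))

theorem sum_abs_secondDiff_le (L m k : ℕ) :
    ∑ j ∈ Finset.Icc 1 m, |secondDiff L j k| ≤ 2 * L + 1 := by
  have : ∀ j, |secondDiff L j k| ≤ if j ∈ Finset.Icc (k - 2 * L) k then 1 else 0 := by
    intro j
    split_ifs with h
    · exact abs_secondDiff_le L j k
    · rw [secondDiff_eq_zero, abs_zero]
      rw [Finset.mem_Icc] at h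
      omega
  refine (Finset.sum_le_sum fun j _ => this j).trans ?_
  rw [Finset.sum_boole]
  have h1 : ((Finset.Icc 1 m).filter fun j => j ∈ Finset.Icc (k - 2 * L) k).card ≤ 2 * L + 1 := by
    refine (Finset.card_le_card fun k hk => (Finset.mem_filter.1 hk).2).trans ?_
    simp only [Nat.card_Icc]
    omega
  exact_mod_cast h1

/-- A side meets at most `2L + 1` windows and `tent` is 1-Lipschitz, so replacing a side costs at
most `2(2L + 1) ≤ 6L`, whatever `R` is. -/
theorem fluctuation_update {n L : ℕ} (hL : 1 ≤ L) (R : ℝ) (x : Fin n → Fin n) (i a : Fin n) :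
    |fluctuation n L R (toDie (Function.update x i a)) - fluctuation n L R (toDie x)| ≤ 6 * L := by
  have hL' : (1 : ℝ) ≤ L := by exact_mod_cast hL
  simp only [fluctuation, toDie]
  rw [← Finset.sum_sub_distrib]
  refine (Finset.abs_sum_le_sum_abs _ _).trans ?_
  have h : ∀ j ∈ Finset.Icc 1 (n - 2 * L),
      |tent R (∑ k, secondDiff L j ((Function.update x i a k : Fin n) + 1)) -
        tent R (∑ k, secondDiff L j ((x k : ℕ) + 1))| ≤
      |secondDiff L j ((a : ℕ) + 1)| + |secondDiff L j ((x i : ℕ) + 1)| := by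
    intro j _
    refine (tent_sub_tent_le _ _ _).trans ?_
    rw [sum_update_sub_sum (fun k : Fin n => secondDiff L j (k + 1)) x i a]
    exact abs_sub _ _
  refine (Finset.sum_le_sum h).trans ?_
  rw [Finset.sum_add_distrib]
  have h1 := sum_abs_secondDiff_le L (n - 2 * L) ((a : ℕ) + 1)
  have h2 := sum_abs_secondDiff_le L (n - 2 * L) ((x i : ℕ) + 1)
  linarith

/-- At least `n / 2` windows contribute, so the mean is at least `n e / 2`; the lower tail is
applied with deviation `n e / 4`. -/
theorem card_fluctuation_le {n L : ℕ} (hL : 1 ≤ L) (hn : 4 * L ≤ n) {R e : ℝ} (he : 0 ≤ e)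
    (h : ∀ j, 1 ≤ j → j + 2 * L ≤ n →
      e ≤ 𝔼 x : Fin n → Fin n, tent R (∑ i, secondDiff L j (toDie x i))) :
    ((Finset.univ.filter fun x : Fin n → Fin n =>
      fluctuation n L R (toDie x) ≤ n * e / 4).card : ℝ) ≤
      (n : ℝ) ^ n * Real.exp (-((n * e / 4) ^ 2 / (2 * n * (6 * L) ^ 2))) := by
  have : Nonempty (Fin n) := ⟨⟨0, by omega⟩⟩
  have hL' : (1 : ℝ) ≤ L := by exact_mod_cast hL
  have hE : n * e / 2 ≤ 𝔼 x : Fin n → Fin n, fluctuation n L R (toDie x) := by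
    simp only [fluctuation]
    rw [Finset.expect_sum_comm]
    refine le_trans ?_ (Finset.card_nsmul_le_sum _ _ e fun j hj => ?_)
    · rw [Nat.card_Icc, Nat.add_sub_cancel, nsmul_eq_mul]
      have : (n : ℝ) ≤ 2 * (n - 2 * L : ℕ) := by exact_mod_cast (by omega : n ≤ 2 * (n - 2 * L))
      nlinarith
    · rw [Finset.mem_Icc] at hj
      exact h j hj.1 (by omega)
  have hn0 : (0 : ℝ) ≤ n := Nat.cast_nonneg n
  have key := card_lower_tail_le (c := 6 * L) (t := n * e / 4) (by positivity) (by positivity)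
    (by omega) (fun x : Fin n → Fin n => fluctuation n L R (toDie x))
    (fun x i a => fluctuation_update hL R x i a)
  rw [Fintype.card_fin] at key
  refine le_trans ?_ key
  refine Nat.cast_le.2 (Finset.card_le_card fun x hx => ?_)
  simp only [Finset.mem_filter, Finset.mem_univ, true_and] at hx ⊢
  linarith

theorem card_fluctuation_le_of_two_le {n L : ℕ} (hL : 2 ≤ L) (hn : 4 * L ≤ n) :
    ((Finset.univ.filter fun x : Fin n → Fin n =>
      fluctuation n L (4 * √L) (toDie x) ≤ n * √L / 32).card : ℝ) ≤
      (n : ℝ) ^ n * Real.exp (-(n / (73728 * L))) := by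
  have : Nonempty (Fin n) := ⟨⟨0, by omega⟩⟩
  have hL' : (2 : ℝ) ≤ L := by exact_mod_cast hL
  have hn0 : (0 : ℝ) < n := by exact_mod_cast (by omega : 0 < n)
  have hsq : √(L : ℝ) ^ 2 = L := Real.sq_sqrt (by linarith)
  have hpos : 0 < √(L : ℝ) := Real.sqrt_pos.2 (by linarith)
  have key := card_fluctuation_le (n := n) (L := L) (R := 4 * √L) (e := √L / 8) (by omega) hn
    (by positivity) (by
      intro j h1 hj
      have hE : ∀ f : Fin n → ℝ, n * 𝔼 k, f k = ∑ k, f k := by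
        intro f
        have := Fintype.card_mul_expect f
        rwa [Fintype.card_fin] at this
      have := le_expect_tent_sum (w := fun k : Fin n => secondDiff L j (k + 1)) (m := n)
        (s := L) (R := 4 * √L)
        (by rw [Fintype.expect_eq_sum_div_card, sum_secondDiff h1 hj, zero_div])
        (fun k => abs_secondDiff_le L j _) (by positivity) (by linarith)
        (by rw [mul_pow, hsq]; norm_num)
        (by rw [hE]; exact le_sum_secondDiff_sq hL hj)
        (by rw [hE]; exact sum_secondDiff_sq_le)
      refine le_trans (le_of_eq ?_) this
      ring)
  have e1 : (n : ℝ) * (√L / 8) / 4 = n * √L / 32 := by ring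
  rw [e1] at key
  refine key.trans (le_of_eq ?_)
  congr 3
  rw [div_pow, mul_pow, hsq]
  field_simp
  norm_num

theorem exp_neg_three_le {n : ℕ} (hn : 4 ≤ n) :
    Real.exp (-3) ≤ (1 - 2 / (n : ℝ)) ^ (n - 1) := by
  have hn' : (4 : ℝ) ≤ n := by exact_mod_cast hn
  have h1 : Real.exp (-(2 / ((n : ℝ) - 2))) ≤ 1 - 2 / (n : ℝ) := by
    rw [Real.exp_neg, inv_le_comm₀ (Real.exp_pos _)
      (by rw [sub_pos, div_lt_one (by linarith)]; linarith)]
    refine le_trans (le_of_eq ?_) (Real.add_one_le_exp _)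
    have : (n : ℝ) - 2 ≠ 0 := by linarith
    field_simp
    ring
  refine le_trans ?_ (pow_le_pow_left₀ (Real.exp_pos _).le h1 _)
  rw [← Real.exp_nat_mul, Nat.cast_sub (by omega)]
  apply Real.exp_le_exp.2
  rw [mul_neg, neg_le_neg_iff, mul_div_assoc', div_le_iff₀ (by linarith)]
  push_cast
  linarith

/-- The variance at `L = 1` is too small for `le_expect_tent_sum`. Instead, only the values `j` and
`j + 2` carry weight, namely `∓1/2`. Exactly one side takes one of them with probability at least `2
exp (-3)`, and then the tent equals `1/2`. -/
theorem le_expect_tent_secondDiff_one {n j : ℕ} (hn : 4 ≤ n) (h1 : 1 ≤ j) (hj : j + 2 ≤ n) :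
    1 / 25 ≤ 𝔼 x : Fin n → Fin n, tent (1 / 2) (∑ i, secondDiff 1 j (toDie x i)) := by
  classical
  have : Nonempty (Fin n) := ⟨⟨0, by omega⟩⟩
  have hn' : (4 : ℝ) ≤ n := by exact_mod_cast hn
  set S : Set (Fin n) := {⟨j - 1, by omega⟩, ⟨j + 1, by omega⟩} with hS
  have hmem : ∀ k : Fin n, k ∈ S ↔ (k : ℕ) + 1 = j ∨ (k : ℕ) + 1 = j + 2 := by
    intro k
    simp only [hS, Set.mem_insert_iff, Set.mem_singleton_iff, Fin.ext_iff]
    omega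
  have hin : ∀ k : Fin n, k ∈ S → |secondDiff 1 j (k + 1)| = 1 / 2 := by
    intro k hk
    rw [hmem] at hk
    unfold secondDiff halfStep
    split_ifs <;> first | omega | norm_num [abs_of_neg]
  have hout : ∀ k : Fin n, k ∉ S → secondDiff 1 j (k + 1) = 0 := by
    intro k hk
    rw [hmem] at hk
    unfold secondDiff halfStep
    split_ifs <;> first | omega | norm_num
  have hpt : ∀ x : Fin n → Fin n, 1 / 2 * (if (∃! i, x i ∈ S) then (1 : ℝ) else 0) ≤
      tent (1 / 2) (∑ i, secondDiff 1 j (toDie x i)) := by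
    intro x
    split_ifs with h
    · obtain ⟨i, hi, hu⟩ := h
      have : ∑ i, secondDiff 1 j (toDie x i) = secondDiff 1 j (x i + 1) :=
        Finset.sum_eq_single i (fun k _ hk => hout _ fun hk' => hk (hu k hk')) (by simp)
      rw [this, tent, hin _ hi]
      norm_num
    · rw [mul_zero]
      exact tent_nonneg _ _
  refine le_trans ?_ (Finset.expect_le_expect fun x _ => hpt x)
  have hmain : (𝔼 x : Fin n → Fin n, if (∃! i, x i ∈ S) then (1 : ℝ) else 0) =
      n * (𝔼 a, if a ∈ S then (1 : ℝ) else 0) *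
        (𝔼 a, if a ∈ S then (0 : ℝ) else 1) ^ (n - 1) := by
    convert expect_exactly_one S n
  rw [← Finset.mul_expect, hmain]
  have hp : (𝔼 a : Fin n, if a ∈ S then (1 : ℝ) else 0) = 2 / n := by
    rw [Fintype.expect_eq_sum_div_card, Fintype.card_fin, Finset.sum_boole]
    have : (Finset.univ.filter fun a => a ∈ S) =
        ({⟨j - 1, by omega⟩, ⟨j + 1, by omega⟩} : Finset (Fin n)) := by
      ext k
      simp [hS]
    rw [this, Finset.card_pair (by simp only [ne_eq, Fin.mk.injEq]; omega)]
    norm_num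
  have hq : (𝔼 a : Fin n, if a ∈ S then (0 : ℝ) else 1) = 1 - 2 / n := by
    rw [← hp, eq_sub_iff_add_eq, ← Finset.expect_add_distrib]
    have : ∀ a : Fin n, ((if a ∈ S then (0 : ℝ) else 1) + if a ∈ S then (1 : ℝ) else 0) = 1 := by
      intro a
      split_ifs <;> norm_num
    simp only [this, Fintype.expect_const]
  rw [hp, hq]
  have h3 := exp_neg_three_le hn
  have h4 : (1 : ℝ) / 25 ≤ Real.exp (-3) := by
    rw [Real.exp_neg, one_div]
    apply inv_anti₀ (Real.exp_pos _)
    have h5 : Real.exp 3 = Real.exp 1 ^ 3 := by rw [← Real.exp_nat_mul]; norm_num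
    rw [h5]
    refine (pow_le_pow_left₀ (Real.exp_pos _).le Real.exp_one_lt_d9.le 3).trans ?_
    norm_num
  have h6 : 1 / 2 * ((n : ℝ) * (2 / n) * (1 - 2 / n) ^ (n - 1)) = (1 - 2 / n) ^ (n - 1) := by
    field_simp
  rw [h6]
  linarith

theorem card_fluctuation_one_le {n : ℕ} (hn : 4 ≤ n) :
    ((Finset.univ.filter fun x : Fin n → Fin n =>
      fluctuation n 1 (1 / 2) (toDie x) ≤ n / 100).card : ℝ) ≤
      (n : ℝ) ^ n * Real.exp (-(n / 720000)) := by
  have hn0 : (0 : ℝ) < n := by exact_mod_cast (by omega : 0 < n)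
  have key := card_fluctuation_le (n := n) (L := 1) (R := 1 / 2) (e := 1 / 25) le_rfl hn
    (by norm_num) (fun j h1 hj => le_expect_tent_secondDiff_one hn h1 hj)
  have e1 : (n : ℝ) * (1 / 25) / 4 = n / 100 := by ring
  rw [e1] at key
  refine key.trans (le_of_eq ?_)
  congr 3
  field_simp
  norm_num

/-- A large fluctuation at scale `L` bounds the exponential sum, uniformly in `β`. -/
theorem norm_sum_le_of_fluctuation {n L : ℕ} (hn : 2 * L ≤ n) {R y : ℝ} (hy : 0 ≤ y)
    (a : Fin n → ℕ) (hfl : y ≤ fluctuation n L R a) {α : ℝ} (β : ℝ) (hα : |α| * (2 * R) ≤ 1 / 2) :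
    ‖∑ j ∈ Finset.Icc 1 n, expCircle (α * dev a j + β * ((j : ℝ) - ((n : ℝ) + 1) / 2))‖ ≤
      n - 4 / 9 * (α ^ 2 * y ^ 2 / n) := by
  refine (norm_sum_expCircle_le_of_second_difference _
    (show n - 2 * L + 2 * L ≤ n by omega)).trans ?_
  rcases Nat.eq_zero_or_pos n with rfl | hn0
  · simp
  have hn0' : (0 : ℝ) < n := by exact_mod_cast hn0
  have hphase : ∀ j : ℕ, α * dev a j + β * ((j : ℝ) - ((n : ℝ) + 1) / 2) -
      2 * (α * dev a (j + L) + β * (((j + L : ℕ) : ℝ) - ((n : ℝ) + 1) / 2)) +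
      (α * dev a (j + 2 * L) + β * (((j + 2 * L : ℕ) : ℝ) - ((n : ℝ) + 1) / 2)) =
      α * ∑ i, secondDiff L j (a i) := by
    intro j
    rw [← dev_second_difference]
    push_cast
    ring
  -- Where the tent is nonzero, `|α t| ≤ 1/2`, so there is no wrap-around; this is the reason for
  -- truncating.
  have hnorm : ∀ t : ℝ, α ^ 2 * tent R t ^ 2 ≤ ‖((α * t : ℝ) : UnitAddCircle)‖ ^ 2 := by
    intro t
    rcases le_total (2 * R) |t| with h | h
    · rw [tent_eq_zero h, zero_pow two_ne_zero, mul_zero]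
      positivity
    · have h1 : |α * t| ≤ 1 / 2 := by
        rw [abs_mul]
        exact (mul_le_mul_of_nonneg_left h (abs_nonneg α)).trans hα
      rw [norm_coe_unitAddCircle_eq_abs h1, sq_abs, mul_pow, ← sq_abs t]
      exact mul_le_mul_of_nonneg_left
        (pow_le_pow_left₀ (tent_nonneg _ _) (tent_le_abs t) 2) (sq_nonneg α)
  simp only [hphase]
  have hcs := sq_sum_le_card_mul_sum_sq (s := Finset.Icc 1 (n - 2 * L))
    (f := fun j => tent R (∑ i, secondDiff L j (a i)))
  rw [Nat.card_Icc, Nat.add_sub_cancel] at hcs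
  have h0 : 0 ≤ ∑ j ∈ Finset.Icc 1 (n - 2 * L), tent R (∑ i, secondDiff L j (a i)) ^ 2 :=
    Finset.sum_nonneg fun j _ => sq_nonneg _
  have h1 : y ^ 2 / n ≤ ∑ j ∈ Finset.Icc 1 (n - 2 * L), tent R (∑ i, secondDiff L j (a i)) ^ 2 := by
    rw [div_le_iff₀' hn0']
    refine (pow_le_pow_left₀ hy hfl 2).trans (hcs.trans ?_)
    exact mul_le_mul_of_nonneg_right (by exact_mod_cast Nat.sub_le n (2 * L)) h0
  have h2 := Finset.sum_le_sum fun j (_ : j ∈ Finset.Icc 1 (n - 2 * L)) =>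
    hnorm (∑ i, secondDiff L j (a i))
  rw [← Finset.mul_sum] at h2
  have h3 := mul_le_mul_of_nonneg_left h1 (sq_nonneg α)
  rw [mul_div_assoc]
  linarith

end Fluctuations

/-! ### Small `α`: the linear phase dominates. -/

section SmallAlpha

/-- The shift should make `b h` large without passing `1/2`. Take `n / 2` if that is allowed, and
otherwise `⌊1/(2b)⌋`, which is at least half of `1/(2b) ≥ 1`. -/
theorem exists_shift {n : ℕ} (hn : 2 ≤ n) {b : ℝ} (hb : b ≤ 1 / 2) (hb0 : 0 ≤ b) :
    ∃ h : ℕ, 2 * h ≤ n ∧ b * h ≤ 1 / 2 ∧ (1 / 4 ≤ b * h ∨ b * n / 3 ≤ b * h) := by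
  by_cases hc : b * (n / 2 : ℕ) ≤ 1 / 2
  · refine ⟨n / 2, by omega, hc, Or.inr ?_⟩
    have : (n : ℝ) ≤ 3 * (n / 2 : ℕ) := by exact_mod_cast (by omega : n ≤ 3 * (n / 2))
    nlinarith
  · push Not at hc
    have hbpos : 0 < b := by
      rcases hb0.eq_or_lt with rfl | h
      · norm_num at hc
      · exact h
    have hfl : (⌊1 / (2 * b)⌋₊ : ℝ) ≤ 1 / (2 * b) := Nat.floor_le (by positivity)
    have hfl' : 1 / (2 * b) < ⌊1 / (2 * b)⌋₊ + 1 := Nat.lt_floor_add_one _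
    have h1 : 1 ≤ ⌊1 / (2 * b)⌋₊ :=
      (Nat.one_le_floor_iff _).2 ((one_le_div (by positivity)).2 (by linarith))
    rw [le_div_iff₀ (by positivity)] at hfl
    rw [div_lt_iff₀ (by positivity)] at hfl'
    have h1' : (1 : ℝ) ≤ ⌊1 / (2 * b)⌋₊ := by exact_mod_cast h1
    refine ⟨⌊1 / (2 * b)⌋₊, ?_, by linarith, Or.inl (by nlinarith)⟩
    have : (⌊1 / (2 * b)⌋₊ : ℝ) ≤ (n / 2 : ℕ) := by
      by_contra hlt
      push Not at hlt
      nlinarith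
    have : ⌊1 / (2 * b)⌋₊ ≤ n / 2 := by exact_mod_cast this
    omega

/-- If `α g_A` is uniformly much smaller than `β n`, then the exponential sum is small. -/
theorem norm_sum_le_of_abs_dev_le {n : ℕ} (hn : 2 ≤ n) (a : Fin n → ℕ) {α β ε : ℝ}
    (hε0 : 0 ≤ ε) (hε : ε ≤ 1 / 40) (hdev : ∀ j, 1 ≤ j → j ≤ n → |α * dev a j| ≤ ε)
    (hβ : |β| ≤ 1 / 2) (hβε : 20 * ε ≤ |β| * n) :
    ‖∑ j ∈ Finset.Icc 1 n, expCircle (α * dev a j + β * ((j : ℝ) - ((n : ℝ) + 1) / 2))‖ ≤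
      n - 16 * n * ε ^ 2 := by
  obtain ⟨h, hh, hup, hlow⟩ := exists_shift hn hβ (abs_nonneg β)
  refine (norm_sum_expCircle_le_of_difference _ (show n - h + h ≤ n by omega)).trans ?_
  -- Both alternatives give `|β| h ≥ 20ε/3`, the first because `ε ≤ 1/40`; after the perturbation
  -- `2ε`, more than `4ε` remains.
  have hbh : 20 / 3 * ε - 2 * ε ≤ |β| * h - 2 * ε := by
    rcases hlow with h | h <;> linarith
  have hj : ∀ j ∈ Finset.Icc 1 (n - h), 16 * ε ^ 2 ≤
      ‖((α * dev a (j + h) + β * (((j + h : ℕ) : ℝ) - ((n : ℝ) + 1) / 2) -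
        (α * dev a j + β * ((j : ℝ) - ((n : ℝ) + 1) / 2)) : ℝ) : UnitAddCircle)‖ ^ 2 := by
    intro j hj
    rw [Finset.mem_Icc] at hj
    have e : α * dev a (j + h) + β * (((j + h : ℕ) : ℝ) - ((n : ℝ) + 1) / 2) -
        (α * dev a j + β * ((j : ℝ) - ((n : ℝ) + 1) / 2)) =
        β * h - (α * dev a j - α * dev a (j + h)) := by
      push_cast
      ring
    have h1 : ‖((α * dev a j - α * dev a (j + h) : ℝ) : UnitAddCircle)‖ ≤ 2 * ε := by
      have h2 : |α * dev a j - α * dev a (j + h)| ≤ 2 * ε := by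
        have := hdev j hj.1 (by omega)
        have := hdev (j + h) (by omega) (by omega)
        refine (abs_sub _ _).trans (by linarith)
      rw [norm_coe_unitAddCircle_eq_abs (h2.trans (by linarith))]
      exact h2
    have h3 : ‖((β * h : ℝ) : UnitAddCircle)‖ = |β| * h := by
      rw [norm_coe_unitAddCircle_eq_abs] <;> rw [abs_mul, Nat.abs_cast]
      exact hup
    have h4 := norm_sub_norm_le ((β * h : ℝ) : UnitAddCircle)
      ((α * dev a j - α * dev a (j + h) : ℝ) : UnitAddCircle)
    rw [← AddCircle.coe_sub, ← e] at h4
    have h5 : 4 * ε ≤ ‖((α * dev a (j + h) + β * (((j + h : ℕ) : ℝ) - ((n : ℝ) + 1) / 2) -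
        (α * dev a j + β * ((j : ℝ) - ((n : ℝ) + 1) / 2)) : ℝ) : UnitAddCircle)‖ := by linarith
    have h6 := pow_le_pow_left₀ (by positivity) h5 2
    linarith
  have hsum := Finset.card_nsmul_le_sum _ _ _ hj
  rw [Nat.card_Icc, Nat.add_sub_cancel, nsmul_eq_mul] at hsum
  have : (n : ℝ) ≤ 2 * (n - h : ℕ) := by exact_mod_cast (by omega : n ≤ 2 * (n - h))
  nlinarith [sq_nonneg ε]

end SmallAlpha

/-! ### Transfer from independent sides to dice. -/

section UniformMeasure

open Classical in
theorem le_uniformOn_real {α : Type*} [MeasurableSpace α] [MeasurableSingletonClass α]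
    {T : Finset α} (hT : T.Nonempty) (S : Set α) {b : ℝ}
    (hb : ((T.filter fun x => x ∉ S).card : ℝ) ≤ b * T.card) :
    1 - b ≤ (uniformOn (T : Set α)).real S := by
  have h1 : uniformOn (T : Set α) S = (T.filter fun x => x ∈ S).card / T.card := by
    rw [← uniformOn_inter_self T.finite_toSet]
    have : (T : Set α) ∩ S = ((T.filter fun x => x ∈ S : Finset α) : Set α) := by
      ext x
      simp
    rw [this, uniformOn_apply_finset, Finset.inter_eq_right.2 (Finset.filter_subset _ _)]
  rw [measureReal_def, h1, ENNReal.toReal_div, ENNReal.toReal_natCast, ENNReal.toReal_natCast,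
    le_div_iff₀ (by exact_mod_cast hT.card_pos)]
  have h2 := Finset.card_filter_add_card_filter_not (s := T) (fun x => x ∈ S)
  have h3 : ((T.filter fun x => x ∈ S).card : ℝ) + (T.filter fun x => x ∉ S).card = T.card := by
    exact_mod_cast h2
  linarith

theorem toDie_injective {n : ℕ} : Function.Injective (toDie (n := n)) := by
  intro x y h
  funext i
  have := congrFun h i
  simp only [toDie] at this
  exact Fin.ext (by omega)

/-- The vectors of `Fin n` that encode dice. -/
def diceCode (n : ℕ) : Finset (Fin n → Fin n) :=
  Finset.univ.filter fun x => ∑ i, toDie x i = n * (n + 1) / 2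

theorem dice_eq_image (n : ℕ) :
    dice n = (((diceCode n).map ⟨toDie, toDie_injective⟩ : Finset (Fin n → ℕ)) :
      Set (Fin n → ℕ)) := by
  ext a
  simp only [dice, Set.mem_ofPred_eq, Finset.coe_map, Function.Embedding.coeFn_mk, Set.mem_image,
    Finset.mem_coe, diceCode, Finset.mem_filter, Finset.mem_univ, true_and]
  constructor
  · rintro ⟨h1, h2⟩
    have e : toDie (fun i => (⟨a i - 1, by have := h1 i; rw [Set.mem_Icc] at this; omega⟩ :
        Fin n)) = a := by
      funext i
      have := h1 i
      rw [Set.mem_Icc] at this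
      simp only [toDie]
      omega
    exact ⟨_, by rw [e]; exact h2, e⟩
  · rintro ⟨x, hx, rfl⟩
    refine ⟨fun i => ?_, hx⟩
    have := (x i).2
    rw [Set.mem_Icc]
    simp only [toDie]
    omega

theorem pow_le_sq_mul_card_diceCode {n : ℕ} (hn : 1 ≤ n) :
    n ^ n ≤ n ^ 2 * (diceCode n).card := by
  obtain ⟨s, hs⟩ : ∃ s : ℕ, n * (n + 1) = 2 * s := (Nat.even_mul_succ_self n).two_dvd
  have h2 : 2 * ((s : ℤ) - n) = n * ((n : ℤ) - 1) := by
    have : (n : ℤ) * (n + 1) = 2 * s := by exact_mod_cast hs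
    linarith
  refine (pow_le_sq_mul_sumCount hn h2).trans (le_of_eq ?_)
  congr 1
  rw [sumCount, diceCode]
  congr 1
  ext x
  simp only [Finset.mem_filter, Finset.mem_univ, true_and, toDie, Finset.sum_add_distrib,
    Finset.sum_const, Finset.card_univ, Fintype.card_fin, smul_eq_mul, mul_one]
  rw [hs, Nat.mul_div_cancel_left _ two_pos, eq_sub_iff_add_eq]
  norm_cast

/-- A set of vectors of density `b / n ^ 2` has density at most `b` among the dice. -/
theorem le_randomDie_real {n : ℕ} (hn : 1 ≤ n) (S : Set (Fin n → ℕ)) (B : Finset (Fin n → Fin n))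
    (hB : ∀ x, x ∉ B → toDie x ∈ S) {b : ℝ} (hb : (n : ℝ) ^ 2 * B.card ≤ b * (n : ℝ) ^ n) :
    1 - b ≤ (randomDie n).real S := by
  classical
  have hn0 : (0 : ℝ) < n := by exact_mod_cast hn
  have hcard : (n : ℝ) ^ n ≤ (n : ℝ) ^ 2 * (diceCode n).card := by
    exact_mod_cast pow_le_sq_mul_card_diceCode hn
  have hb0 : 0 ≤ b := by
    by_contra h
    push Not at h
    have : b * (n : ℝ) ^ n < 0 := mul_neg_of_neg_of_pos h (by positivity)
    have : (0 : ℝ) ≤ (n : ℝ) ^ 2 * B.card := by positivity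
    linarith
  rw [randomDie, dice_eq_image]
  refine le_uniformOn_real ?_ S ?_
  · rw [Finset.map_nonempty, ← Finset.card_pos, Nat.pos_iff_ne_zero]
    intro h
    rw [h] at hcard
    have : (0 : ℝ) < (n : ℝ) ^ n := by positivity
    norm_num at hcard
    linarith
  · rw [Finset.card_map, Finset.filter_map, Finset.card_map]
    have h1 : ((diceCode n).filter
        ((fun x => x ∉ S) ∘ (⟨toDie, toDie_injective⟩ : (Fin n → Fin n) ↪ (Fin n → ℕ)))).card ≤
        B.card := by
      refine Finset.card_le_card fun x hx => ?_
      by_contra h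
      exact (Finset.mem_filter.1 hx).2 (hB x h)
    have h2 : (n : ℝ) ^ 2 * B.card ≤ (n : ℝ) ^ 2 * (b * (diceCode n).card) := by
      nlinarith
    have h3 := le_of_mul_le_mul_left h2 (by positivity)
    refine le_trans ?_ h3
    exact_mod_cast h1

end UniformMeasure

/-! ### The three ranges of frequencies and the exceptional set. -/

section Conclusion

/-- The large scale at which fluctuations are measured. -/
noncomputable def largeScale (n : ℕ) : ℕ := ⌊(n : ℝ) / (10 ^ 8 * Real.log n)⌋₊

/-- With `q = log n / n`, the cases are `|α| ≥ 625 √q` (scale 1), `10^7 q ≤ |α| ≤ 625 √q` (large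
scale), and `|α| < 10^7 q`, where `β` must be large. -/
theorem norm_charFn_pow_le_of_good {n : ℕ} (hn : 4 ≤ n) (hl1 : 1 ≤ Real.log n)
    (hl3 : 10 ^ 19 * Real.log n ^ 3 ≤ n) (a : Fin n → ℕ)
    (hdev : ∀ j, 1 ≤ j → j ≤ n → |dev a j| ≤ 5 * √(n * Real.log n))
    (hone : (n : ℝ) / 100 ≤ fluctuation n 1 (1 / 2) a)
    (hlarge : n * √(largeScale n) / 32 ≤
      fluctuation n (largeScale n) (4 * √(largeScale n)) a)
    {α β : ℝ} (hα : |α| ≤ 1 / 2) (hβ : |β| ≤ 1 / 2)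
    (h : 10 ^ 7 * (Real.log n / n) ≤ |α| ∨ 10 ^ 9 * (Real.log n / n) ^ (3 / 2 : ℝ) ≤ |β|) :
    ‖charFn a α β‖ ^ n ≤ (n : ℝ) ^ (-10 : ℤ) := by
  have hn0 : (0 : ℝ) < n := by exact_mod_cast (by omega : 0 < n)
  refine norm_charFn_pow_le (by omega) a α β ?_
  set l := Real.log n with hl
  have hl0 : 0 < l := by linarith
  set q := l / n with hq
  have hq0 : 0 < q := by positivity
  have hqn : q * n = l := div_mul_cancel₀ _ hn0.ne'
  have hsq : √q ^ 2 = q := Real.sq_sqrt hq0.le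
  have hsq0 : 0 < √q := Real.sqrt_pos.2 hq0
  rcases le_total (625 * √q) |α| with h1 | h1
  · refine (norm_sum_le_of_fluctuation (by omega) (by positivity) a hone β (by linarith)).trans ?_
    have h2 : 390625 * q ≤ α ^ 2 := by
      have := pow_le_pow_left₀ (by positivity) h1 2
      rw [mul_pow, hsq, sq_abs] at this
      linarith
    have e : α ^ 2 * ((n : ℝ) / 100) ^ 2 / n = α ^ 2 * n / 10000 := by
      field_simp
      norm_num
    rw [e]
    nlinarith
  · rcases le_or_gt (10 ^ 7 * q) |α| with h2 | h2
    · have hX : 2 ≤ (n : ℝ) / (10 ^ 8 * l) := by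
        rw [le_div_iff₀ (by positivity)]
        nlinarith [pow_le_pow_left₀ zero_le_one hl1 2]
      have hfl : (largeScale n : ℝ) ≤ n / (10 ^ 8 * l) := Nat.floor_le (by positivity)
      have hfl' : (n : ℝ) / (10 ^ 8 * l) < largeScale n + 1 := Nat.lt_floor_add_one _
      set L := largeScale n with hL
      have hLn : (L : ℝ) * (10 ^ 8 * l) ≤ n := (le_div_iff₀ (by positivity)).1 hfl
      have hLn' : (n : ℝ) ≤ 2 * L * (10 ^ 8 * l) := by
        rw [← div_le_iff₀ (by positivity)]
        linarith
      have hL0 : (0 : ℝ) ≤ L := Nat.cast_nonneg _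
      have hLs : √(L : ℝ) ^ 2 = L := Real.sq_sqrt hL0
      have h2L : 2 * L ≤ n := by
        have : (2 * L : ℝ) ≤ n := by nlinarith
        exact_mod_cast this
      -- The `10^8` in `largeScale` is chosen for this: `|α| * 8√L ≤ 625 * 8 / 10^4 = 1/2`.
      have hqL : √q * √(L : ℝ) ≤ 1 / 10 ^ 4 := by
        rw [← Real.sqrt_mul hq0.le]
        refine Real.sqrt_le_iff.2 ⟨by norm_num, ?_⟩
        rw [hq, div_mul_eq_mul_div, div_le_iff₀ hn0]
        linarith
      refine (norm_sum_le_of_fluctuation h2L (by positivity) a hlarge β ?_).trans ?_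
      · have := mul_le_mul_of_nonneg_right h1 (Real.sqrt_nonneg (L : ℝ))
        linarith
      · have e : α ^ 2 * (n * √(L : ℝ) / 32) ^ 2 / n = α ^ 2 * (n * L) / 1024 := by
          rw [div_pow, mul_pow, hLs]
          field_simp
          norm_num
        rw [e]
        have h3 : 10 ^ 14 * q ^ 2 ≤ α ^ 2 := by
          have := pow_le_pow_left₀ (by positivity) h2 2
          rw [mul_pow, sq_abs] at this
          linarith
        have h4 : l ≤ q ^ 2 * (n * L) * (2 * 10 ^ 8) := by
          have : q ^ 2 * (n * L) * (2 * 10 ^ 8) = q * (2 * L * (10 ^ 8 * l)) := by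
            rw [← hqn]
            ring
          rw [this]
          exact hqn.symm.le.trans (mul_le_mul_of_nonneg_left hLn' hq0.le)
        have h5 := mul_le_mul_of_nonneg_right h3 (mul_nonneg hn0.le hL0)
        linarith
    · have hsn : √(n * l) = n * √q := by
        rw [← hqn, show (n : ℝ) * (q * n) = n ^ 2 * q by ring, Real.sqrt_mul (sq_nonneg _),
          Real.sqrt_sq hn0.le]
      have hrpow : q ^ (3 / 2 : ℝ) = q * √q := by
        rw [show (3 / 2 : ℝ) = 1 + 1 / 2 by norm_num, Real.rpow_add hq0, Real.rpow_one,
          Real.sqrt_eq_rpow]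
      have hβ' : 10 ^ 9 * (q * √q) ≤ |β| := by
        rw [hrpow] at h
        rcases h with h | h
        · exact absurd h h2.not_ge
        · exact h
      -- This is `10^7 q` times the bound `5 √(n log n)` on `g_A`, and `20 ε = 10^9 q^(3/2) n`
      -- matches the threshold for `β`.
      set ε := 5 * 10 ^ 7 * (q * n * √q) with hε
      have hε2 : ε ^ 2 = 25 * 10 ^ 14 * (l ^ 2 * q) := by
        rw [hε, hqn, mul_pow, mul_pow, mul_pow, hsq]
        ring
      have hε0 : 0 ≤ ε := by positivity
      refine (norm_sum_le_of_abs_dev_le (by omega) a hε0 ?_ ?_ hβ ?_).trans ?_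
      · have : ε ^ 2 ≤ (1 / 40) ^ 2 := by
          rw [hε2, hq, ← mul_div_assoc, ← mul_div_assoc, div_le_iff₀ hn0]
          nlinarith
        exact le_of_sq_le_sq this (by norm_num)
      · intro j hj1 hj2
        rw [abs_mul]
        have := mul_le_mul h2.le (hdev j hj1 hj2) (abs_nonneg _) (by positivity)
        rw [hsn] at this
        refine this.trans (le_of_eq ?_)
        rw [hε]
        ring
      · have := mul_le_mul_of_nonneg_right hβ' hn0.le
        rw [hε]
        linarith
      · rw [hε2]
        have : 16 * n * (25 * 10 ^ 14 * (l ^ 2 * q)) = 4 * 10 ^ 16 * l ^ 3 := by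
          rw [← hqn]
          ring
        rw [this]
        nlinarith [pow_le_pow_left₀ zero_le_one hl1 2]

/-- The factor `10^19` is what makes the perturbation `ε` at most `1/40` in the small-`α` case. -/
theorem eventually_log_bounds :
    ∃ N : ℕ, ∀ n : ℕ, N ≤ n →
      4 ≤ n ∧ 1 ≤ Real.log n ∧ 10 ^ 19 * Real.log n ^ 3 ≤ n := by
  have h1 : ∀ᶠ x : ℝ in Filter.atTop, 1 ≤ Real.log x :=
    Real.tendsto_log_atTop.eventually_ge_atTop 1
  have h2 : ∀ᶠ x : ℝ in Filter.atTop, 10 ^ 19 * Real.log x ^ 3 ≤ x := by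
    have := (Real.isLittleO_pow_log_id_atTop (n := 3)).bound
      (show (0 : ℝ) < 1 / 10 ^ 19 by norm_num)
    filter_upwards [this, Filter.eventually_ge_atTop 0] with x hx hx0
    rw [id, Real.norm_of_nonneg hx0] at hx
    have := (le_abs_self _).trans hx
    linarith
  have h3 := tendsto_natCast_atTop_atTop (R := ℝ) |>.eventually (h1.and h2)
  obtain ⟨N, hN⟩ := Filter.eventually_atTop.1 (h3.and (Filter.eventually_ge_atTop 4))
  exact ⟨N, fun n hn => ⟨(hN n hn).2, (hN n hn).1⟩⟩

-- Each of the three failures has density at most `n^(-8)` among all vectors, leaving room for the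
-- factor `n²` lost by conditioning on the sum. The sup bound has tail `2 n^(-25/2)` for each `j`,
-- before a union over `n` indices.
open Classical in
theorem exists_exceptional_set {n : ℕ} (hn : 4 ≤ n) (hl1 : 1 ≤ Real.log n)
    (hl3 : 10 ^ 19 * Real.log n ^ 3 ≤ n) :
    ∃ B : Finset (Fin n → Fin n),
      (B.card : ℝ) ≤ 3 * ((n : ℝ) ^ n * Real.exp (-(8 * Real.log n))) ∧
      ∀ x, x ∉ B → (∀ j, 1 ≤ j → j ≤ n → |dev (toDie x) j| ≤ 5 * √(n * Real.log n)) ∧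
        (n : ℝ) / 100 ≤ fluctuation n 1 (1 / 2) (toDie x) ∧
        n * √(largeScale n) / 32 ≤
          fluctuation n (largeScale n) (4 * √(largeScale n)) (toDie x) := by
  have hn0 : (0 : ℝ) < n := by exact_mod_cast (by omega : 0 < n)
  set l := Real.log n with hl
  have hl0 : 0 < l := by linarith
  have hnl : 10 ^ 19 * l ≤ n := by nlinarith [pow_le_pow_left₀ zero_le_one hl1 2]
  set B1 := (Finset.Icc 1 n).biUnion fun j =>
    Finset.univ.filter fun x : Fin n → Fin n => 5 * √(n * l) ≤ |dev (toDie x) j| with hB1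
  set B2 := Finset.univ.filter fun x : Fin n → Fin n =>
      fluctuation n 1 (1 / 2) (toDie x) ≤ n / 100 with hB2
  set B3 := Finset.univ.filter fun x : Fin n → Fin n =>
      fluctuation n (largeScale n) (4 * √(largeScale n)) (toDie x) ≤
        n * √(largeScale n) / 32 with hB3
  have c1 : (B1.card : ℝ) ≤ (n : ℝ) ^ n * Real.exp (-(8 * l)) := by
    have hj : ∀ j ∈ Finset.Icc 1 n, ((Finset.univ.filter fun x : Fin n → Fin n =>
        5 * √(n * l) ≤ |dev (toDie x) j|).card : ℝ) ≤
        2 * (n : ℝ) ^ n * Real.exp (-(25 / 2 * l)) := by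
      intro j hj
      rw [Finset.mem_Icc] at hj
      refine (card_le_abs_dev hj.1 hj.2 (by positivity)).trans (le_of_eq ?_)
      congr 3
      rw [mul_pow, Real.sq_sqrt (by positivity)]
      field_simp
      norm_num
    have h1 : (B1.card : ℝ) ≤ ∑ j ∈ Finset.Icc 1 n, ((Finset.univ.filter fun x : Fin n → Fin n =>
        5 * √(n * l) ≤ |dev (toDie x) j|).card : ℝ) := by
      exact_mod_cast Finset.card_biUnion_le
    refine (h1.trans (Finset.sum_le_card_nsmul _ _ _ hj)).trans ?_
    rw [Nat.card_Icc, Nat.add_sub_cancel, nsmul_eq_mul]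
    have h2 : (n : ℝ) * Real.exp (-(25 / 2 * l)) = Real.exp (l + -(25 / 2 * l)) := by
      rw [Real.exp_add, hl, Real.exp_log hn0]
    have h3 : 2 * Real.exp (l + -(25 / 2 * l)) ≤ Real.exp (-(8 * l)) := by
      have h4 : (2 : ℝ) ≤ Real.exp l := by linarith [Real.add_one_le_exp l]
      calc 2 * Real.exp (l + -(25 / 2 * l)) ≤ Real.exp l * Real.exp (l + -(25 / 2 * l)) :=
            mul_le_mul_of_nonneg_right h4 (Real.exp_pos _).le
        _ = Real.exp (l + (l + -(25 / 2 * l))) := (Real.exp_add _ _).symm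
        _ ≤ _ := Real.exp_le_exp.2 (by linarith)
    calc (n : ℝ) * (2 * (n : ℝ) ^ n * Real.exp (-(25 / 2 * l)))
        = (n : ℝ) ^ n * (2 * (n * Real.exp (-(25 / 2 * l)))) := by ring
      _ ≤ _ := by
        rw [h2]
        exact mul_le_mul_of_nonneg_left h3 (by positivity)
  have c2 : (B2.card : ℝ) ≤ (n : ℝ) ^ n * Real.exp (-(8 * l)) := by
    refine (card_fluctuation_one_le hn).trans ?_
    refine mul_le_mul_of_nonneg_left (Real.exp_le_exp.2 ?_) (by positivity)
    linarith
  have c3 : (B3.card : ℝ) ≤ (n : ℝ) ^ n * Real.exp (-(8 * l)) := by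
    have hX : 2 ≤ (n : ℝ) / (10 ^ 8 * l) := by
      rw [le_div_iff₀ (by positivity)]
      linarith
    have hL2 : 2 ≤ largeScale n := Nat.le_floor (by exact_mod_cast hX)
    have hfl : (largeScale n : ℝ) ≤ n / (10 ^ 8 * l) := Nat.floor_le (by positivity)
    have hLn : (largeScale n : ℝ) * (10 ^ 8 * l) ≤ n := (le_div_iff₀ (by positivity)).1 hfl
    have hL2' : (2 : ℝ) ≤ largeScale n := by exact_mod_cast hL2
    have h4L : 4 * largeScale n ≤ n := by
      have : (4 * largeScale n : ℝ) ≤ n := by nlinarith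
      exact_mod_cast this
    refine (card_fluctuation_le_of_two_le hL2 h4L).trans ?_
    refine mul_le_mul_of_nonneg_left (Real.exp_le_exp.2 ?_) (by positivity)
    rw [neg_le_neg_iff, le_div_iff₀ (by positivity)]
    have : 0 ≤ (largeScale n : ℝ) * l := by positivity
    linarith
  refine ⟨B1 ∪ (B2 ∪ B3), ?_, ?_⟩
  · have h1 : ((B1 ∪ (B2 ∪ B3)).card : ℝ) ≤ B1.card + (B2.card + B3.card) := by
      exact_mod_cast (Finset.card_union_le _ _).trans
        (Nat.add_le_add_left (Finset.card_union_le _ _) _)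
    linarith
  · intro x hx
    simp only [Finset.mem_union, not_or] at hx
    obtain ⟨x1, x2, x3⟩ := hx
    refine ⟨fun j hj1 hj2 => ?_, ?_, ?_⟩
    · by_contra h
      push Not at h
      exact x1 (Finset.mem_biUnion.2 ⟨j, Finset.mem_Icc.2 ⟨hj1, hj2⟩,
        Finset.mem_filter.2 ⟨Finset.mem_univ _, h.le⟩⟩)
    · by_contra h
      push Not at h
      exact x2 (Finset.mem_filter.2 ⟨Finset.mem_univ _, h.le⟩)
    · by_contra h
      push Not at h
      exact x3 (Finset.mem_filter.2 ⟨Finset.mem_univ _, h.le⟩)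

end Conclusion

end IntransitiveDice

theorem mainTheorem5 :
    ∃ N : ℕ, ∀ n : ℕ, N ≤ n →
      1 - (n : ℝ) ^ (-5 : ℤ) ≤
        (IntransitiveDice.randomDie n).real
          {a : Fin n → ℕ |
            ∀ α β : ℝ, α ∈ Set.Icc (-(1 / 2) : ℝ) (1 / 2) → β ∈ Set.Icc (-(1 / 2) : ℝ) (1 / 2) →
              (10 ^ 7 * (Real.log n / n) ≤ |α| ∨
                10 ^ 9 * (Real.log n / n) ^ (3 / 2 : ℝ) ≤ |β|) →
              ‖IntransitiveDice.charFn a α β‖ ^ n ≤ (n : ℝ) ^ (-10 : ℤ)} := by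
  obtain ⟨N, hN⟩ := IntransitiveDice.eventually_log_bounds
  refine ⟨N, fun n hn => ?_⟩
  obtain ⟨hn4, hl1, hl3⟩ := hN n hn
  obtain ⟨B, hBcard, hB⟩ := IntransitiveDice.exists_exceptional_set hn4 hl1 hl3
  refine IntransitiveDice.le_randomDie_real (by omega) _ B (fun x hx => ?_) ?_
  · obtain ⟨h1, h2, h3⟩ := hB x hx
    intro α β hα hβ h
    exact IntransitiveDice.norm_charFn_pow_le_of_good hn4 hl1 hl3 _ h1 h2 h3
      (abs_le.2 hα) (abs_le.2 hβ) h
  · have hn4' : (4 : ℝ) ≤ n := by exact_mod_cast hn4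
    have hn0 : (0 : ℝ) < n := by linarith
    have e8 : Real.exp (-(8 * Real.log n)) = ((n : ℝ) ^ 8)⁻¹ := by
      rw [Real.exp_neg, ← Real.exp_log (pow_pos hn0 8), Real.log_pow]
      norm_num
    have e5 : (n : ℝ) ^ (-5 : ℤ) = ((n : ℝ) ^ 5)⁻¹ := by
      rw [zpow_neg]
      norm_cast
    rw [e8] at hBcard
    rw [e5]
    calc (n : ℝ) ^ 2 * B.card ≤ (n : ℝ) ^ 2 * (3 * ((n : ℝ) ^ n * ((n : ℝ) ^ 8)⁻¹)) :=
          mul_le_mul_of_nonneg_left hBcard (by positivity)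
      -- The factor `3` is absorbed into `n`, which turns `3 n^(-6)` into `n^(-5)`.
      _ ≤ (n : ℝ) ^ 2 * (n * ((n : ℝ) ^ n * ((n : ℝ) ^ 8)⁻¹)) := by
          gcongr
          linarith
      _ = _ := by field_simp
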